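/- \textbf{Setting.} Let $H$ be an $N\times N$ Hermitian matrix ($N\ge 1$) with eigenvalues $E_0\le E_1\le\dots\le E_{N-1}$ in $[-1,1]$ and orthonormal eigenvectors $|E_i\rangle$, let $|\psi_0\rangle$ be a unit vector with $\gamma_0=\langle E_0|\psi_0\rangle\neq 0$, and let $D\ge 1$. With $T_k$ the Chebyshev polynomials of the first kind, put $|\psi_k\rangle=T_k(H)|\psi_0\rangle$ for $0\le k<D$ and let $$\mathbf H_{ij}=\langle\psi_i|H|\psi_j\rangle,\qquad \mathbf S_{ij}=\langle\psi_i|\psi_j\rangle ,$$ with $(\lambda_i,\mathbf v_i)_{i=1}^{D}$ an orthonormal system of eigenpairs of $\mathbf S$, $\lambda_1\ge\dots\ge\lambda_D$. For Hermitian $D\times D$ perturbations $\boldsymbol\Delta_H,\boldsymbol\Delta_S$ with spectral norms $\eta_H,\eta_S$ put $\widetilde{\mathbf H}=\mathbf H+\boldsymbol\Delta_H$, $\widetilde{\mathbf S}=\mathbf S+\boldsymbol\Delta_S$ and $\eta=\sqrt{\eta_H^2+\eta_S^2}$. For a threshold $\epsilon>0$, the regularized problem of a pair $(\mathbf A,\mathbf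 B)$ is the generalized eigenvalue problem $\mathbf A\mathbf x=F\,\mathbf B\mathbf x$ with $\mathbf A$ and $\mathbf B$ both projected onto the span of the eigenvectors of $\mathbf B$ with eigenvalue $>\epsilon$. Let $\widetilde E_0'$ be the lowest eigenvalue of the regularized problem of $(\widetilde{\mathbf H},\widetilde{\mathbf S})$, let $\mathcal E=|\widetilde E_0'-E_0|$, and let $\epsilon_{\rm total}=\sum_{i:\lambda_i\le\epsilon}\lambda_i$. \textbf{Admissible thresholds.} Let $0\le\alpha\le 1/2$. Call $\epsilon>0$ admissible at noise levels $(\eta_H,\eta_S)$ if $2\sqrt{D\epsilon}<|\gamma_0|$ and there are $\mu,\rho>0$ such that (1) $\lambda_i+\eta_S\le\epsilon$ whenever $\lambda_i\le\epsilon$; (2) $|\mathbf v_i^\dagger\mathbf H\mathbf v_j|\le\mu\min(\lambda_i,\lambda_j)^{1-\alpha}\max(\lambda_i,\lambda_j)^{\alpha}$ for all $i,j$; (3) $(1+\rho)\epsilon\le\lambda_i$ whenever $\lambda_i>\epsilon$, and $D^4\chi\le\epsilon$, where $\chi=3(2+\mu)(1+\tfrac1\rho)\left(\|\mathbf S\|/\epsilon\right)^{\alpha}\eta_S+\eta_H$;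 (4) $\arctan E_1'-\arctan E_0'\ge\arcsin(D^4\chi/\epsilon)$, where $E_0'\le E_1'$ are the two lowest eigenvalues (with multiplicity) of the regularized problem of the noiseless pair $(\mathbf H,\mathbf S)$ (no condition if there is only one eigenvalue). Call a noise rate $\eta\ge 0$ small enough if some $\epsilon$ is admissible at all noise levels $\eta_H,\eta_S\ge 0$ with $\eta_H^2+\eta_S^2=\eta^2$. \textbf{Theorem.} There are absolute constants $c,C>0$ such that for all $H,|\psi_0\rangle,D$ as above, every choice of the eigenvectors and every $\alpha\in[0,1/2]$: (i) All sufficiently small noise rates are small enough: there is $\eta_1>0$ (which may depend on $H,|\psi_0\rangle,D,\alpha$ and the chosen eigenvectors) such that every $0\le\eta\le\eta_1$ is small enough. (ii) If $\eta$ is small enough, there is a threshold $\epsilon\ge c\,(D^4\eta)^{1/(1+\alpha)}$, $\epsilon>0$, such that for all Hermitian $\boldsymbol\Delta_H,\boldsymbol\Delta_S$ of total noise rate $\eta$ the estimate $\widetilde E_0'$ exists and, for every $\delta>0$, $$\mathcal E\le C\left((D^4\eta)^{\frac1{1+\alpha}}+\frac{\sqrt\delta\,\epsilon_{\rm total}}{|\gamma_0|^2}+\delta+\frac1{|\gamma_0|^2}\left(1+\frac\delta2\right)^{-D}\right).$$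 (iii) For all Hermitian $\boldsymbol\Delta_H,\boldsymbol\Delta_S$, at every threshold $\epsilon$ that is admissible at their actual noise levels $(\|\boldsymbol\Delta_H\|,\|\boldsymbol\Delta_S\|)$, the estimate $\widetilde E_0'$ exists and the same bound holds for every $\delta>0$. -/

import Mathlib

noncomputable section

/-- The action of a complex matrix on the Euclidean (`ℓ²`) space. -/
abbrev act {n : ℕ} (A : Matrix (Fin n) (Fin n) ℂ) (x : EuclideanSpace ℂ (Fin n)) :
    EuclideanSpace ℂ (Fin n) :=
  Matrix.toEuclideanLin A x

/-- The spectral norm of a complex matrix: its operator norm on the Euclidean space. -/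
def specNorm {n : ℕ} (A : Matrix (Fin n) (Fin n) ℂ) : ℝ :=
  ‖Matrix.toEuclideanCLM (n := Fin n) (𝕜 := ℂ) A‖

/-- The Chebyshev Krylov vector `T_k(H) ψ₀`. -/
def krylovVec {N : ℕ} (H : Matrix (Fin N) (Fin N) ℂ) (ψ₀ : EuclideanSpace ℂ (Fin N)) (k : ℕ) :
    EuclideanSpace ℂ (Fin N) :=
  act (Polynomial.aeval H (Polynomial.Chebyshev.T ℂ (k : ℤ))) ψ₀

/-- The overlap matrix `S i j = ⟨ψ_i, ψ_j⟩`, `0 ≤ i, j < D`, of the Krylov vectors. -/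
def overlapMatrix {N : ℕ} (H : Matrix (Fin N) (Fin N) ℂ) (ψ₀ : EuclideanSpace ℂ (Fin N))
    (D : ℕ) : Matrix (Fin D) (Fin D) ℂ :=
  Matrix.of fun i j => inner ℂ (krylovVec H ψ₀ i) (krylovVec H ψ₀ j)

/-- The projected Hamiltonian `H i j = ⟨ψ_i, H ψ_j⟩`, `0 ≤ i, j < D`. -/
def projectedMatrix {N : ℕ} (H : Matrix (Fin N) (Fin N) ℂ) (ψ₀ : EuclideanSpace ℂ (Fin N))
    (D : ℕ) : Matrix (Fin D) (Fin D) ℂ :=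
  Matrix.of fun i j => inner ℂ (krylovVec H ψ₀ i) (act H (krylovVec H ψ₀ j))

/-- The subspace kept by thresholding: the span of the eigenvectors of `B` whose eigenvalue
is above `ε`. -/
def keptSpace {D : ℕ} (B : Matrix (Fin D) (Fin D) ℂ) (ε : ℝ) :
    Submodule ℂ (EuclideanSpace ℂ (Fin D)) :=
  Submodule.span ℂ {x | ∃ t : ℝ, ε < t ∧ act B x = (t : ℂ) • x}

/-- `(F, x)` is an eigenpair of the generalized eigenvalue problem `A x = F B x` after both
`A` and `B` have been projected onto `keptSpace B ε`. -/
def IsRegularizedEigenpair {D : ℕ} (A B : Matrix (Fin D) (Fin D) ℂ) (ε F : ℝ)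
    (x : EuclideanSpace ℂ (Fin D)) : Prop :=
  x ∈ keptSpace B ε ∧ x ≠ 0 ∧
    ∀ y ∈ keptSpace B ε, inner ℂ y (act A x) = (F : ℂ) * inner ℂ y (act B x)

/-- The eigenvalues of the regularized generalized eigenvalue problem. -/
def regularizedEigenvalues {D : ℕ} (A B : Matrix (Fin D) (Fin D) ℂ) (ε : ℝ) : Set ℝ :=
  {F | ∃ x, IsRegularizedEigenpair A B ε F x}

/-- `E'` is the lowest eigenvalue of the regularized problem. -/
def IsLowest {D : ℕ} (A B : Matrix (Fin D) (Fin D) ℂ) (ε E' : ℝ) : Prop :=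
  IsLeast (regularizedEigenvalues A B ε) E'

/-- `E₁'` is the second-to-lowest eigenvalue of the regularized problem, counted with
multiplicity, where `E₀'` is the lowest one: the least eigenvalue with an eigenvector that is
linearly independent of an eigenvector for `E₀'`. -/
def IsSecondLowest {D : ℕ} (A B : Matrix (Fin D) (Fin D) ℂ) (ε E₀' E₁' : ℝ) : Prop :=
  IsLeast {F | ∃ x₀ x₁, IsRegularizedEigenpair A B ε E₀' x₀ ∧
    IsRegularizedEigenpair A B ε F x₁ ∧ LinearIndependent ℂ ![x₀, x₁]} E₁'

/-- The total noise rate `η = √(‖Δ_H‖² + ‖Δ_S‖²)`. -/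
def noiseRate {D : ℕ} (ΔH ΔS : Matrix (Fin D) (Fin D) ℂ) : ℝ :=
  √(specNorm ΔH ^ 2 + specNorm ΔS ^ 2)

/-- The quantity `χ = 3 (2 + μ) (1 + 1/ρ) (‖S‖/ε)^α η_S + η_H`. -/
def chi (normS α μ ρ ε ηH ηS : ℝ) : ℝ :=
  3 * (2 + μ) * (1 + 1 / ρ) * (normS / ε) ^ α * ηS + ηH

/-- The sum of the eigenvalues `lam i` that are discarded by thresholding at `ε`. -/
def discardedSum {D : ℕ} (lam : Fin D → ℝ) (ε : ℝ) : ℝ :=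
  ∑ i with lam i ≤ ε, lam i

/-- The assumptions under which the error bound is claimed, for the noiseless pair `(A, B)`
with eigenpairs `(lam i, v i)` of `B`, the exponent `α`, the constants `μ, ρ`, the threshold `ε`
and the noise levels `ηH, ηS`. -/
structure NoiseAssumptions {D : ℕ} (A B : Matrix (Fin D) (Fin D) ℂ) (lam : Fin D → ℝ)
    (v : Fin D → EuclideanSpace ℂ (Fin D)) (α μ ρ ε ηH ηS : ℝ) : Prop where
  /-- The eigenvalues of `B` that are discarded stay below the threshold under noise. -/
  gap_at_threshold : ∀ i, lam i ≤ ε → lam i + ηS ≤ ε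
  /-- Bound on `A` relative to `B`. -/
  relative_bound : ∀ i j, ‖inner ℂ (v i) (act A (v j))‖ ≤
    μ * min (lam i) (lam j) ^ (1 - α) * max (lam i) (lam j) ^ α
  /-- Relative gap above the threshold: `(1 + ρ) ε` is at most the least kept eigenvalue. -/
  gap_above : ∀ i, ε < lam i → (1 + ρ) * ε ≤ lam i
  /-- Bound on the noise rate relative to the threshold. -/
  noise_bound : (D : ℝ) ^ 4 * chi (specNorm B) α μ ρ ε ηH ηS ≤ ε
  /-- Gap condition; there is nothing to check if only one eigenvalue is kept. -/
  gap_condition : ∀ E₀' E₁', IsLowest A B ε E₀' → IsSecondLowest A B ε E₀' E₁' →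
    Real.arcsin ((D : ℝ) ^ 4 * chi (specNorm B) α μ ρ ε ηH ηS / ε) ≤
      Real.arctan E₁' - Real.arctan E₀'

/-- The threshold `ε` is admissible at the noise levels `ηH, ηS`: the assumptions above hold for
some constants `μ, ρ > 0`, and `ε` is small relative to the overlap `g = |γ₀|`. -/
def AdmissibleThreshold {D : ℕ} (A B : Matrix (Fin D) (Fin D) ℂ) (lam : Fin D → ℝ)
    (v : Fin D → EuclideanSpace ℂ (Fin D)) (g α ε ηH ηS : ℝ) : Prop :=
  0 < ε ∧ 2 * √(D * ε) < g ∧ ∃ μ > 0, ∃ ρ > 0, NoiseAssumptions A B lam v α μ ρ ε ηH ηS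

/-- The noise rate `η` is small enough that the assumptions can be satisfied: some threshold is
admissible, however the total noise `η` is distributed between the two matrices. -/
def NoiseSmallEnough {D : ℕ} (A B : Matrix (Fin D) (Fin D) ℂ) (lam : Fin D → ℝ)
    (v : Fin D → EuclideanSpace ℂ (Fin D)) (g α η : ℝ) : Prop :=
  ∃ ε, ∀ ηH ηS : ℝ, 0 ≤ ηH → 0 ≤ ηS → ηH ^ 2 + ηS ^ 2 = η ^ 2 →
    AdmissibleThreshold A B lam v g α ε ηH ηS

/-- The expression inside the `O(·)` of the error bound, with `g = |γ₀|`. -/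
def errorScale (D : ℕ) (α η εtot g δ : ℝ) : ℝ :=
  ((D : ℝ) ^ 4 * η) ^ (1 / (1 + α)) + √δ * εtot / g ^ 2 + δ
    + 1 / g ^ 2 * ((1 + δ / 2) ^ D)⁻¹

end

/-! The Krylov map `V c = ∑ c_k ψ_k` factors both matrices: `S = V†V`, and the projected Hamiltonian
is `V†HV`. The estimate is therefore the minimum, over the noisy kept space, of a perturbed version
of the quotient `⟨Vx, H Vx⟩ / ‖Vx‖²`. On that space the noisy overlap form is at least `ε‖x‖²`,
while `D⁴(6η_S + η_H) ≤ ε`, so noise contributes only `O(1/D)`. Such an error is free: `δ + (1 +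
δ/2)^(-D)/|γ₀|²` is at least `1/(2D)` for every `δ` (`inv_le_two_mul_add_inv_pow`). The lower bound
on the estimate is then immediate, and the upper bound needs one trial vector.

The trial vector comes from a polynomial `p` of degree below `D` with `p(E₀) = 1`, `|p| ≤ 1` on
`[-1,1]`, and `p²` at most `16(1 + δ/2)^(-D)` at distance `δ` or more from `E₀`
(`exists_chebyshev_filter`). Its Chebyshev coefficient vector `c` satisfies `Vc = p(H)ψ₀`, which has
norm at least `|γ₀|` and little excess energy. Projecting `c` onto the kept space costs at most
`(ε_total + 2η_S)‖c‖²` in squared norm (`exists_mem_keptSpace_of_norm_sq_le_two`). Since `p(cos θ)`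
lives on an arc of length `O(√δ)`, Bessel's inequality gives `‖c‖² ≤ 4√δ + 32(1 + δ/2)^(-D)`, whence
the term `√δ ε_total/|γ₀|²`.

The size of the threshold follows by putting all the noise into `S`: as `‖S‖ ≥ 1`, the noise bound
forces `D⁴η ≤ ε^(1+α)`. For small noise, a threshold below the positive eigenvalues of `S` discards
only its kernel. The three-term recurrence then makes the noiseless spectrum simple
(`lt_of_isSecondLowest`), so the gap is positive and the conditions hold for all small `η`. -/

noncomputable section

/-! ### Chebyshev coefficients of peaked polynomials -/

open Polynomial.Chebyshev in
/-- Every polynomial of degree less than `D` is a combination of `T_0, …, T_{D-1}`. -/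
theorem exists_chebyshev_expansion {D : ℕ} {P : Polynomial ℝ} (hP : P.degree < D) :
    ∃ c : Fin D → ℝ, ∀ x, P.eval x = ∑ k, c k * (T ℝ ((k : ℕ) : ℤ)).eval x := by
  let S : Polynomial.Sequence ℝ := ⟨fun n => T ℝ n, fun n => by simp [degree_T]⟩
  have hspan := S.span_degreeLT (m := D) fun i _ => (by
    rw [isUnit_iff_ne_zero, Polynomial.leadingCoeff_ne_zero]; exact S.ne_zero i)
  have hset : S '' Set.Iio D = Set.range fun k : Fin D => T ℝ ((k : ℕ) : ℤ) := by
    ext Q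
    constructor
    · rintro ⟨i, hi, rfl⟩
      exact ⟨⟨i, hi⟩, rfl⟩
    · rintro ⟨k, rfl⟩
      exact ⟨k, k.2, rfl⟩
  have hmem : P ∈ Submodule.span ℝ (Set.range fun k : Fin D => T ℝ ((k : ℕ) : ℤ)) := by
    rw [← hset, hspan, Polynomial.mem_degreeLT]
    exact hP
  obtain ⟨c, rfl⟩ := (Submodule.mem_span_range_iff_exists_fun ℝ).1 hmem
  exact ⟨c, fun x => by simp [Polynomial.eval_finsetSum]⟩

open Polynomial.Chebyshev in
/-- Bessel's inequality for Chebyshev coefficients. -/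
theorem sum_sq_chebyshev_coeff_le {D : ℕ} (c : Fin D → ℝ) :
    Real.pi / 2 * ∑ k, c k ^ 2 ≤
      ∫ θ in 0..Real.pi, (∑ k, c k * (T ℝ ((k : ℕ) : ℤ)).eval (Real.cos θ)) ^ 2 := by
  rw [← integral_measureT_eq_integral_cos
    (f := fun x => (∑ k, c k * (T ℝ ((k : ℕ) : ℤ)).eval x) ^ 2)]
  have hexp : ∀ x : ℝ, (∑ k, c k * (T ℝ ((k : ℕ) : ℤ)).eval x) ^ 2 =
      ∑ k, ∑ j, (c k * c j) *
        ((T ℝ ((k : ℕ) : ℤ)).eval x * (T ℝ ((j : ℕ) : ℤ)).eval x) := by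
    intro x
    rw [sq, Finset.sum_mul_sum]
    exact Finset.sum_congr rfl fun k _ => Finset.sum_congr rfl fun j _ => by ring
  simp_rw [hexp]
  have hint : ∀ k j : Fin D, MeasureTheory.Integrable (fun x : ℝ => (c k * c j) *
        ((T ℝ ((k : ℕ) : ℤ)).eval x * (T ℝ ((j : ℕ) : ℤ)).eval x)) measureT :=
    fun k j => integrable_measureT (by fun_prop)
  rw [MeasureTheory.integral_finsetSum _ fun k _ =>
    MeasureTheory.integrable_finsetSum _ fun j _ => hint k j, Finset.mul_sum]
  refine Finset.sum_le_sum fun k _ => ?_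
  rw [MeasureTheory.integral_finsetSum _ fun j _ => hint k j]
  simp_rw [MeasureTheory.integral_const_mul]
  rw [Finset.sum_eq_single k]
  -- `T_0` has squared norm `π` and every other `T_k` has `π/2`, hence an inequality rather than an
  -- equality.
  · have hd : Real.pi / 2 ≤ ∫ x, (T ℝ ((k : ℕ) : ℤ)).eval x * (T ℝ ((k : ℕ) : ℤ)).eval x
        ∂measureT := by
      by_cases hk : (k : ℕ) = 0
      · have := integral_eval_T_real_mul_self_measureT_zero
        rw [hk, Nat.cast_zero, this]
        linarith [Real.pi_pos]
      · rw [integral_T_real_mul_self_measureT_of_ne_zero hk]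
    nlinarith [mul_le_mul_of_nonneg_left hd (sq_nonneg (c k))]
  · intro j _ hj
    rw [integral_eval_T_real_mul_eval_T_real_measureT_of_ne, mul_zero]
    exact fun h => hj (Fin.ext h.symm)
  · simp

/-- The cosine separates points of `[0, π]` at least quadratically. -/
theorem sq_sub_le_abs_cos_sub_cos {x y : ℝ} (hx : x ∈ Set.Icc 0 Real.pi)
    (hy : y ∈ Set.Icc 0 Real.pi) :
    2 * ((x - y) / Real.pi) ^ 2 ≤ |Real.cos x - Real.cos y| := by
  wlog hxy : y ≤ x generalizing x y
  · have := this hy hx (le_of_not_ge hxy)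
    rw [abs_sub_comm]
    calc _ = 2 * ((y - x) / Real.pi) ^ 2 := by ring
      _ ≤ _ := this
  have hpi := Real.pi_pos
  -- Jordan's inequality. Both sines in the product formula for `cos x - cos y` are at least this.
  have h1 : 2 / Real.pi * ((x - y) / 2) ≤ Real.sin ((x - y) / 2) :=
    Real.mul_le_sin (by linarith) (by linarith [hx.2, hy.1])
  have h0 : 0 ≤ 2 / Real.pi * ((x - y) / 2) := by
    have : 0 ≤ x - y := by linarith
    positivity
  have h2 : Real.sin ((x - y) / 2) ≤ Real.sin ((x + y) / 2) := by
    have hd : Real.sin ((x + y) / 2) - Real.sin ((x - y) / 2) =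
        2 * Real.sin (y / 2) * Real.cos (x / 2) := by
      rw [Real.sin_sub_sin]
      ring_nf
    have : 0 ≤ Real.sin (y / 2) :=
      Real.sin_nonneg_of_nonneg_of_le_pi (by linarith [hy.1]) (by linarith [hy.2])
    have : 0 ≤ Real.cos (x / 2) :=
      Real.cos_nonneg_of_neg_pi_div_two_le_of_le (by linarith [hx.1]) (by linarith [hx.2])
    have : 0 ≤ 2 * Real.sin (y / 2) * Real.cos (x / 2) := by positivity
    linarith
  rw [Real.cos_sub_cos]
  have h3 : 0 ≤ Real.sin ((x - y) / 2) := h0.trans h1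
  rw [abs_mul, abs_mul, abs_of_nonneg h3, abs_of_nonneg (h3.trans h2)]
  have h4 : (x - y) / Real.pi = 2 / Real.pi * ((x - y) / 2) := by ring
  rw [h4]
  norm_num
  nlinarith

/-- The Chebyshev coefficients of a polynomial bounded by one that is small away from `a`. -/
theorem sum_sq_chebyshev_coeff_le_of_peak {D : ℕ} (c : Fin D → ℝ) {a δ τ : ℝ}
    (ha : a ∈ Set.Icc (-1 : ℝ) 1) (hδ : 0 ≤ δ) (hτ : 0 ≤ τ)
    (hone : ∀ x ∈ Set.Icc (-1 : ℝ) 1,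
      |∑ k, c k * (Polynomial.Chebyshev.T ℝ ((k : ℕ) : ℤ)).eval x| ≤ 1)
    (hfar : ∀ x ∈ Set.Icc (-1 : ℝ) 1, δ ≤ |x - a| →
      (∑ k, c k * (Polynomial.Chebyshev.T ℝ ((k : ℕ) : ℤ)).eval x) ^ 2 ≤ τ) :
    ∑ k, c k ^ 2 ≤ 4 * √δ + 2 * τ := by
  have hpi := Real.pi_pos
  have hB := sum_sq_chebyshev_coeff_le c
  set p : ℝ → ℝ := fun x => ∑ k, c k * (Polynomial.Chebyshev.T ℝ ((k : ℕ) : ℤ)).eval x with hp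
  set b := Real.arccos a with hb
  have hbm : b ∈ Set.Icc 0 Real.pi := ⟨Real.arccos_nonneg a, Real.arccos_le_pi a⟩
  have hcosb : Real.cos b = a := Real.cos_arccos ha.1 ha.2
  -- Angles farther than `π√δ` from `arccos a` have cosines at distance at least `2δ` from `a`.
  set r : ℝ := Real.pi * √δ with hr
  have hr0 : 0 ≤ r := by positivity
  let I : Set ℝ := Set.Icc (b - r) (b + r)
  have hpt : ∀ θ ∈ Set.Icc 0 Real.pi, p (Real.cos θ) ^ 2 ≤ τ + I.indicator (fun _ => (1 : ℝ)) θ := by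
    intro θ hθ
    have hcm : Real.cos θ ∈ Set.Icc (-1 : ℝ) 1 := Real.cos_mem_Icc θ
    by_cases hI : θ ∈ I
    · rw [Set.indicator_of_mem hI]
      have := (sq_le_one_iff_abs_le_one _).2 (hone _ hcm)
      linarith
    · rw [Set.indicator_of_notMem hI, add_zero]
      refine hfar _ hcm ?_
      have h1 := sq_sub_le_abs_cos_sub_cos hθ hbm
      rw [hcosb] at h1
      refine le_trans ?_ h1
      have h2 : r ≤ |θ - b| := by
        by_contra hlt
        rw [not_le, abs_lt] at hlt
        exact hI ⟨by linarith, by linarith⟩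
      have h3 : √δ ≤ |(θ - b) / Real.pi| := by
        rw [abs_div, abs_of_pos hpi, le_div_iff₀ hpi]
        linarith [mul_comm Real.pi √δ]
      have h4 := mul_self_le_mul_self (Real.sqrt_nonneg δ) h3
      rw [Real.mul_self_sqrt hδ, abs_mul_abs_self] at h4
      nlinarith
  have hcont : Continuous fun θ => p (Real.cos θ) ^ 2 := by
    simp only [hp]
    fun_prop
  have hind : MeasureTheory.Integrable (I.indicator (fun _ => (1 : ℝ))) := by
    rw [MeasureTheory.integrable_indicator_iff measurableSet_Icc]
    exact MeasureTheory.integrableOn_const (by simp)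
  have hle : ∫ θ in 0..Real.pi, p (Real.cos θ) ^ 2 ≤ Real.pi * τ + 2 * r := by
    calc _ ≤ ∫ θ in 0..Real.pi, (τ + I.indicator (fun _ => (1 : ℝ)) θ) :=
          intervalIntegral.integral_mono_on hpi.le (hcont.intervalIntegrable _ _)
            (intervalIntegrable_const.add hind.intervalIntegrable) hpt
      _ = Real.pi * τ + ∫ θ in 0..Real.pi, I.indicator (fun _ => (1 : ℝ)) θ := by
          rw [intervalIntegral.integral_add intervalIntegrable_const hind.intervalIntegrable]
          simp
      _ ≤ Real.pi * τ + 2 * r := by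
          gcongr
          rw [intervalIntegral.integral_of_le hpi.le]
          calc _ ≤ ∫ θ, I.indicator (fun _ => (1 : ℝ)) θ :=
                MeasureTheory.setIntegral_le_integral hind
                  (Filter.Eventually.of_forall fun θ => Set.indicator_nonneg (by simp) θ)
            _ = 2 * r := by
                rw [MeasureTheory.integral_indicator measurableSet_Icc]
                simp
                rw [max_eq_left (by linarith)]
                ring
  have h5 := hB.trans hle
  have h6 : Real.pi / 2 * ∑ k, c k ^ 2 ≤ Real.pi / 2 * (4 * √δ + 2 * τ) := by
    refine h5.trans (le_of_eq ?_)
    rw [hr]; ring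
  exact le_of_mul_le_mul_left h6 (by positivity)

/-! ### The Chebyshev filter -/

open Polynomial.Chebyshev in
theorem half_one_add_pow_le_eval_T (l : ℕ) {s : ℝ} (hs : 0 ≤ s) :
    (1 + √(2 * s)) ^ l / 2 ≤ (T ℝ (l : ℤ)).eval (1 + s) := by
  have h1 : (1 : ℝ) ≤ 1 + s := by linarith
  set u := Real.arcosh (1 + s) with hu
  have hcu : Real.cosh u = 1 + s := Real.cosh_arcosh h1
  have hsu : Real.sinh u = √((1 + s) ^ 2 - 1) := Real.sinh_arcosh h1
  rw [← hcu, T_real_cosh]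
  -- `e^u = cosh u + sinh u`, and `sinh² u = 2s + s²`.
  have h2 : 1 + √(2 * s) ≤ Real.exp u := by
    rw [← Real.cosh_add_sinh, hcu, hsu]
    have : √(2 * s) ≤ √((1 + s) ^ 2 - 1) := Real.sqrt_le_sqrt (by nlinarith)
    linarith
  have h3 : (1 + √(2 * s)) ^ l ≤ Real.exp (l * u) := by
    rw [Real.exp_nat_mul]
    gcongr
  rw [Real.cosh_eq]
  have := Real.exp_pos (-(l * u))
  push_cast
  linarith

open Polynomial.Chebyshev in
theorem eval_T_le_eval_T_of_one_le (l : ℕ) {x y : ℝ} (hx : 1 ≤ x) (hxy : x ≤ y) :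
    (T ℝ (l : ℤ)).eval x ≤ (T ℝ (l : ℤ)).eval y := by
  have h0 := Real.arcosh_nonneg hx
  have h2 : Real.arcosh x ≤ Real.arcosh y :=
    (Real.arcosh_le_arcosh (by linarith) (by linarith)).2 hxy
  have hx' : x = Real.cosh (Real.arcosh x) := (Real.cosh_arcosh hx).symm
  have hy' : y = Real.cosh (Real.arcosh y) := (Real.cosh_arcosh (hx.trans hxy)).symm
  have h1 := h0.trans h2
  generalize Real.arcosh x = u at *
  generalize Real.arcosh y = w at *
  subst hx' hy'
  rw [T_real_cosh, T_real_cosh, Real.cosh_le_cosh, abs_of_nonneg (by positivity),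
    abs_of_nonneg (by positivity)]
  gcongr

open Polynomial.Chebyshev in
/-- A polynomial of degree less than `D` peaked at `a`, with its Chebyshev coefficients. -/
theorem exists_chebyshev_filter {D : ℕ} (hD : 1 ≤ D) {a δ : ℝ} (ha : a ∈ Set.Icc (-1 : ℝ) 1)
    (hδ : 0 < δ) (hδ1 : δ < 1) :
    ∃ c : Fin D → ℝ, (∑ k, c k * (T ℝ ((k : ℕ) : ℤ)).eval a = 1) ∧
      (∀ x ∈ Set.Icc (-1 : ℝ) 1, |∑ k, c k * (T ℝ ((k : ℕ) : ℤ)).eval x| ≤ 1) ∧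
      (∀ x ∈ Set.Icc (-1 : ℝ) 1, δ ≤ |x - a| →
        (∑ k, c k * (T ℝ ((k : ℕ) : ℤ)).eval x) ^ 2 ≤ 16 * ((1 + δ / 2) ^ D)⁻¹) := by
  -- The filter is `T_l ∘ q` normalized at `a`, of degree at most `2l ≤ D - 1`. The quadratic `q`
  -- sends distances between `δ` and `2` from `a` into `[-1, 1]`, and `a` itself beyond `1`, where
  -- `T_l` grows exponentially.
  set l := (D - 1) / 2 with hl
  set m : ℝ := 4 - δ ^ 2 with hm
  have hm0 : 0 < m := by nlinarith
  -- `q x = 1 + 2 (δ² - (x - a)²) / (4 - δ²)`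
  set q : Polynomial ℝ := Polynomial.C (1 + 2 * δ ^ 2 / m) -
    Polynomial.C (2 / m) * (Polynomial.X - Polynomial.C a) ^ 2 with hq
  have hqe : ∀ x, q.eval x = 1 + 2 * (δ ^ 2 - (x - a) ^ 2) / m := by
    intro x; simp [hq]; ring
  set t := (T ℝ (l : ℤ)).eval (q.eval a) with ht
  have hqa : q.eval a = 1 + 2 * δ ^ 2 / m := by rw [hqe]; ring
  have ht1 : 1 ≤ t := by
    rw [ht]
    refine one_le_eval_T_real _ ?_
    rw [hqa]
    have : 0 ≤ 2 * δ ^ 2 / m := by positivity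
    linarith
  have ht2 : (1 + δ) ^ l / 2 ≤ t := by
    rw [ht, hqa]
    refine le_trans ?_ (half_one_add_pow_le_eval_T l (by positivity))
    have : δ ≤ √(2 * (2 * δ ^ 2 / m)) := by
      refine Real.le_sqrt_of_sq_le ?_
      rw [← mul_div_assoc, le_div_iff₀ hm0]
      nlinarith [sq_nonneg δ]
    gcongr
  set P : Polynomial ℝ := Polynomial.C t⁻¹ * (T ℝ (l : ℤ)).comp q with hP
  have hPe : ∀ x, P.eval x = (T ℝ (l : ℤ)).eval (q.eval x) / t := by
    intro x; simp [hP]; ring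
  have hqdeg : q.natDegree ≤ 2 := by
    rw [hq]; compute_degree
  have hPdeg : P.degree < D := by
    have h1 : P.natDegree ≤ l * 2 := by
      calc P.natDegree ≤ ((T ℝ (l : ℤ)).comp q).natDegree := Polynomial.natDegree_C_mul_le _ _
        _ = (T ℝ (l : ℤ)).natDegree * q.natDegree := Polynomial.natDegree_comp
        _ ≤ l * 2 := by
            rw [natDegree_T]
            exact Nat.mul_le_mul (by simp) hqdeg
    refine lt_of_le_of_lt Polynomial.degree_le_natDegree ?_
    exact_mod_cast (show P.natDegree < D by omega)
  obtain ⟨c, hc⟩ := exists_chebyshev_expansion hPdeg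
  have hlow : ∀ x ∈ Set.Icc (-1 : ℝ) 1, -1 ≤ q.eval x := by
    intro x hx
    rw [hqe]
    have : -2 ≤ 2 * (δ ^ 2 - (x - a) ^ 2) / m := by
      rw [le_div_iff₀ hm0]
      nlinarith [hx.1, hx.2, ha.1, ha.2, mul_nonneg (by linarith [hx.1, ha.2] : 0 ≤ 2 + (x - a))
        (by linarith [hx.2, ha.1] : 0 ≤ 2 - (x - a))]
    linarith
  refine ⟨c, ?_, ?_, ?_⟩
  · rw [← hc, hPe]
    exact div_self (by linarith)
  · intro x hx
    rw [← hc, hPe, abs_div, abs_of_pos (by linarith : 0 < t), div_le_one (by linarith)]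
    rcases le_total (q.eval x) 1 with h | h
    · exact (abs_eval_T_real_le_one _ (abs_le.2 ⟨hlow x hx, h⟩)).trans ht1
    · rw [abs_of_nonneg (zero_le_one.trans (one_le_eval_T_real _ h))]
      refine eval_T_le_eval_T_of_one_le l h ?_
      rw [hqa, hqe]
      gcongr
      nlinarith [sq_nonneg (x - a)]
  · intro x hx hxa
    have h1 : q.eval x ≤ 1 := by
      rw [hqe]
      have : 2 * (δ ^ 2 - (x - a) ^ 2) / m ≤ 0 := by
        refine div_nonpos_of_nonpos_of_nonneg ?_ hm0.le
        have := mul_self_le_mul_self hδ.le hxa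
        rw [abs_mul_abs_self] at this
        nlinarith
      linarith
    have h2 := abs_eval_T_real_le_one (l : ℤ) (abs_le.2 ⟨hlow x hx, h1⟩)
    rw [← hc, hPe, div_pow]
    have h3 : (T ℝ (l : ℤ)).eval (q.eval x) ^ 2 ≤ 1 := (sq_le_one_iff_abs_le_one _).2 h2
    have h4 : (1 + δ) ^ (2 * l) / 4 ≤ t ^ 2 := by
      calc (1 + δ) ^ (2 * l) / 4 = ((1 + δ) ^ l / 2) ^ 2 := by ring
        _ ≤ t ^ 2 := by gcongr
    -- The constant `16`: one factor `4` squares the `1/2` in the growth of `T_l`; the other bounds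
    -- `(1 + δ)²`, lost because `2l` may be as small as `D - 2`.
    have h5 : (1 + δ / 2) ^ D ≤ 4 * (1 + δ) ^ (2 * l) := by
      calc (1 + δ / 2) ^ D ≤ (1 + δ) ^ (2 * l + 2) := by
            calc _ ≤ (1 + δ) ^ D := by gcongr; linarith
              _ ≤ _ := pow_le_pow_right₀ (by linarith) (by omega)
        _ = (1 + δ) ^ 2 * (1 + δ) ^ (2 * l) := by ring
        _ ≤ 4 * (1 + δ) ^ (2 * l) := by gcongr; nlinarith
    have h6 : 0 < (1 + δ / 2) ^ D := by positivity
    rw [div_le_iff₀ (by positivity), mul_assoc, inv_mul_eq_div]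
    have : (1 : ℝ) ≤ 16 * (t ^ 2 / (1 + δ / 2) ^ D) := by
      rw [← mul_div_assoc, le_div_iff₀ h6]
      linarith
    linarith

/-! ### Quadratic forms and definite pencils -/

/-- The real part of the quadratic form of a matrix. -/
def quadForm {n : ℕ} (A : Matrix (Fin n) (Fin n) ℂ) (x : EuclideanSpace ℂ (Fin n)) : ℝ :=
  (inner ℂ x (act A x)).re

theorem act_add_left {n : ℕ} (A B : Matrix (Fin n) (Fin n) ℂ) (x : EuclideanSpace ℂ (Fin n)) :
    act (A + B) x = act A x + act B x := by
  simp [act]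

theorem act_mul {n : ℕ} (A B : Matrix (Fin n) (Fin n) ℂ) (x : EuclideanSpace ℂ (Fin n)) :
    act (A * B) x = act A (act B x) := by
  simp [act, Matrix.toEuclideanLin, Matrix.toLpLin_apply]

theorem quadForm_add_left {n : ℕ} (A B : Matrix (Fin n) (Fin n) ℂ)
    (x : EuclideanSpace ℂ (Fin n)) : quadForm (A + B) x = quadForm A x + quadForm B x := by
  simp [quadForm, act_add_left]

theorem quadForm_smul {n : ℕ} (A : Matrix (Fin n) (Fin n) ℂ) (c : ℂ)
    (x : EuclideanSpace ℂ (Fin n)) : quadForm A (c • x) = ‖c‖ ^ 2 * quadForm A x := by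
  simp only [quadForm, act, map_smul, inner_smul_left, inner_smul_right]
  rw [← mul_assoc, Complex.mul_conj, Complex.normSq_eq_norm_sq,
    Complex.re_ofReal_mul]

theorem continuous_quadForm {n : ℕ} (A : Matrix (Fin n) (Fin n) ℂ) :
    Continuous (quadForm A) := by
  have : Continuous (act A) := LinearMap.continuous_of_finiteDimensional _
  unfold quadForm
  fun_prop

theorem specNorm_nonneg {n : ℕ} (A : Matrix (Fin n) (Fin n) ℂ) : 0 ≤ specNorm A :=
  norm_nonneg _

theorem norm_act_le {n : ℕ} (A : Matrix (Fin n) (Fin n) ℂ) (x : EuclideanSpace ℂ (Fin n)) :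
    ‖act A x‖ ≤ specNorm A * ‖x‖ :=
  (Matrix.toEuclideanCLM (n := Fin n) (𝕜 := ℂ) A).le_opNorm x

theorem abs_quadForm_le {n : ℕ} (A : Matrix (Fin n) (Fin n) ℂ) (x : EuclideanSpace ℂ (Fin n)) :
    |quadForm A x| ≤ specNorm A * ‖x‖ ^ 2 := by
  calc |quadForm A x| ≤ ‖inner ℂ x (act A x)‖ := Complex.abs_re_le_norm _
    _ ≤ ‖x‖ * ‖act A x‖ := norm_inner_le_norm _ _
    _ ≤ ‖x‖ * (specNorm A * ‖x‖) := by gcongr; exact norm_act_le A x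
    _ = _ := by ring

theorem inner_act_left {n : ℕ} {A : Matrix (Fin n) (Fin n) ℂ} (hA : A.IsHermitian)
    (x y : EuclideanSpace ℂ (Fin n)) : inner ℂ (act A x) y = inner ℂ x (act A y) :=
  Matrix.isSymmetric_toEuclideanLin_iff.2 hA x y

theorem inner_act_self {n : ℕ} {A : Matrix (Fin n) (Fin n) ℂ} (hA : A.IsHermitian)
    (x : EuclideanSpace ℂ (Fin n)) : inner ℂ x (act A x) = (quadForm A x : ℂ) := by
  refine (Complex.conj_eq_iff_re.1 ?_).symm
  rw [inner_conj_symm, inner_act_left hA]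

theorem quadForm_add_right {n : ℕ} {A : Matrix (Fin n) (Fin n) ℂ} (hA : A.IsHermitian)
    (x y : EuclideanSpace ℂ (Fin n)) :
    quadForm A (x + y) = quadForm A x + 2 * (inner ℂ y (act A x)).re + quadForm A y := by
  have h : (inner ℂ x (act A y)).re = (inner ℂ y (act A x)).re := by
    rw [← inner_act_left hA, ← inner_conj_symm, Complex.conj_re]
  simp only [quadForm, act, map_add, inner_add_left, inner_add_right, Complex.add_re] at *
  linarith

/-- A form that is nonnegative on a subspace is degenerate at each of its zeros there. -/
theorem inner_act_eq_zero_of_quadForm_nonneg {n : ℕ} {A : Matrix (Fin n) (Fin n) ℂ}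
    (hA : A.IsHermitian) {K : Submodule ℂ (EuclideanSpace ℂ (Fin n))}
    (hK : ∀ x ∈ K, 0 ≤ quadForm A x) {x : EuclideanSpace ℂ (Fin n)} (hx : x ∈ K)
    (h0 : quadForm A x = 0) {y : EuclideanSpace ℂ (Fin n)} (hy : y ∈ K) :
    inner ℂ y (act A x) = 0 := by
  set w := inner ℂ y (act A x) with hw
  set G := quadForm A y with hG
  have hG0 : 0 ≤ G := hK y hy
  -- Moving `x` by `-t w y` changes the form by `-t‖w‖²(2 - tG)`; this `t` keeps `tG < 1`, so `w ≠
  -- 0` would make the form negative.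
  set t : ℝ := 1 / (G + 1) with ht
  have ht0 : 0 < t := by positivity
  have h := hK (x + (-(t : ℂ) * w) • y) (K.add_mem hx (K.smul_mem _ hy))
  rw [quadForm_add_right hA, h0, quadForm_smul, inner_smul_left, ← hw, ← hG] at h
  have h1 : ((starRingEnd ℂ) (-(t : ℂ) * w) * w).re = -t * ‖w‖ ^ 2 := by
    rw [map_mul, mul_assoc, mul_comm ((starRingEnd ℂ) w), Complex.mul_conj,
      Complex.normSq_eq_norm_sq, map_neg, Complex.conj_ofReal, ← Complex.ofReal_neg,
      ← Complex.ofReal_mul, Complex.ofReal_re]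
  rw [h1, norm_mul, norm_neg, Complex.norm_real, Real.norm_eq_abs, abs_of_pos ht0] at h
  have h2 : t * (G + 1) = 1 := by rw [ht]; field_simp
  have h3 : t * ‖w‖ ^ 2 * (2 - t * G) ≤ 0 := by linarith [h]
  have h4 : 1 ≤ 2 - t * G := by linarith
  have h5 : t * ‖w‖ ^ 2 ≤ 0 := by
    by_contra! hpos
    nlinarith
  have h6 : ‖w‖ ^ 2 ≤ 0 := by
    by_contra! hpos
    nlinarith
  have h7 : ‖w‖ = 0 := by nlinarith [norm_nonneg w]
  exact norm_eq_zero.1 h7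

/-- A definite pencil on a nonzero subspace has a lowest eigenvalue, the least value of the
generalized Rayleigh quotient. -/
theorem exists_lowest_pencil_eigenvalue {n : ℕ} {A B : Matrix (Fin n) (Fin n) ℂ}
    (hA : A.IsHermitian) (hB : B.IsHermitian) {K : Submodule ℂ (EuclideanSpace ℂ (Fin n))}
    (hK : K ≠ ⊥) (hpos : ∀ x ∈ K, x ≠ 0 → 0 < quadForm B x) :
    ∃ F : ℝ, (∀ x ∈ K, F * quadForm B x ≤ quadForm A x) ∧ ∃ x ∈ K, x ≠ 0 ∧
      quadForm A x = F * quadForm B x ∧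
      ∀ y ∈ K, inner ℂ y (act A x) = (F : ℂ) * inner ℂ y (act B x) := by
  have hcomp : IsCompact (Metric.sphere (0 : EuclideanSpace ℂ (Fin n)) 1 ∩ K) :=
    (isCompact_sphere _ _).inter_right K.closed_of_finiteDimensional
  have hnorm : ∀ x ∈ K, x ≠ 0 →
      ((‖x‖ : ℂ)⁻¹ • x) ∈ Metric.sphere (0 : EuclideanSpace ℂ (Fin n)) 1 ∩ K := by
    intro x hx hx0
    refine ⟨?_, K.smul_mem _ hx⟩
    rw [mem_sphere_zero_iff_norm, norm_smul, norm_inv, Complex.norm_real, norm_norm,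
      inv_mul_cancel₀ (norm_ne_zero_iff.2 hx0)]
  obtain ⟨u, hu, hu0⟩ := (Submodule.ne_bot_iff K).1 hK
  have hne0 : ∀ x ∈ Metric.sphere (0 : EuclideanSpace ℂ (Fin n)) 1 ∩ K, x ≠ 0 :=
    fun x hx => ne_zero_of_mem_unit_sphere ⟨x, hx.1⟩
  obtain ⟨x, hx, hmin⟩ := hcomp.exists_isMinOn ⟨_, hnorm u hu hu0⟩
    (f := fun x => quadForm A x / quadForm B x)
    ((continuous_quadForm A).continuousOn.div (continuous_quadForm B).continuousOn
      fun x hx => (hpos x hx.2 (hne0 x hx)).ne')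
  have hBx := hpos x hx.2 (hne0 x hx)
  set F := quadForm A x / quadForm B x with hF
  have hFx : quadForm A x = F * quadForm B x := by rw [hF]; field_simp
  have hle : ∀ y ∈ K, F * quadForm B y ≤ quadForm A y := by
    intro y hy
    by_cases hy0 : y = 0
    · subst hy0; simp [quadForm]
    · have hm := hmin (hnorm y hy hy0)
      simp only [Set.mem_ofPred_eq, quadForm_smul] at hm
      have hpos' := hpos y hy hy0
      have hc : 0 < ‖((‖y‖ : ℂ)⁻¹)‖ ^ 2 := by
        have : 0 < ‖y‖ := norm_pos_iff.2 hy0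
        simp only [norm_inv, Complex.norm_real, norm_norm]
        positivity
      rw [mul_div_mul_left _ _ hc.ne', le_div_iff₀ hpos'] at hm
      exact hm
  refine ⟨F, hle, x, hx.2, hne0 x hx, hFx, fun y hy => ?_⟩
  have hM : (A - (F : ℂ) • B).IsHermitian := by
    refine hA.sub ?_
    rw [Matrix.IsHermitian, Matrix.conjTranspose_smul, hB.eq]
    simp
  have hact : ∀ z, act (A - (F : ℂ) • B) z = act A z - (F : ℂ) • act B z := by
    intro z; simp only [act, map_sub, map_smul, LinearMap.sub_apply, LinearMap.smul_apply]
  have hq : ∀ z, quadForm (A - (F : ℂ) • B) z = quadForm A z - F * quadForm B z := by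
    intro z
    rw [quadForm, hact, inner_sub_right, inner_smul_right, Complex.sub_re, Complex.re_ofReal_mul]
    rfl
  -- `A - F B` is nonnegative on `K` and vanishes at the minimizer, so its form is degenerate there:
  -- this is the eigenvalue equation.
  have h := inner_act_eq_zero_of_quadForm_nonneg hM (K := K)
    (fun z hz => by rw [hq]; linarith [hle z hz]) hx.2 (by rw [hq]; linarith) hy
  rw [hact, inner_sub_right, inner_smul_right, sub_eq_zero] at h
  exact h

/-! ### Eigenvalue perturbation and thresholding -/

section Eigenbasis

variable {n : ℕ} {A : Matrix (Fin n) (Fin n) ℂ} {s : Fin n → ℝ}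
  {b : OrthonormalBasis (Fin n) ℂ (EuclideanSpace ℂ (Fin n))}

theorem inner_eigenvector_act (hb : ∀ i, act A (b i) = (s i : ℂ) • b i) (i : Fin n)
    (x : EuclideanSpace ℂ (Fin n)) :
    inner ℂ (b i) (act A x) = (s i : ℂ) * inner ℂ (b i) x := by
  have h : act A x = ∑ j, ((s j : ℂ) * inner ℂ (b j) x) • b j := by
    conv_lhs => rw [← b.sum_repr' x]
    simp only [act, map_sum, map_smul]
    refine Finset.sum_congr rfl fun j _ => ?_
    have := hb j
    simp only [act] at this
    rw [this, smul_smul, mul_comm]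
  rw [h, inner_sum, Finset.sum_eq_single i]
  · rw [inner_smul_right, b.inner_eq_one, mul_one]
  · intro j _ hj
    rw [inner_smul_right, b.inner_eq_zero hj.symm, mul_zero]
  · simp

theorem quadForm_eq_sum (hb : ∀ i, act A (b i) = (s i : ℂ) • b i)
    (x : EuclideanSpace ℂ (Fin n)) :
    quadForm A x = ∑ i, s i * ‖inner ℂ (b i) x‖ ^ 2 := by
  rw [quadForm, ← b.sum_inner_mul_inner, Complex.re_sum]
  refine Finset.sum_congr rfl fun i _ => ?_
  rw [inner_eigenvector_act hb, ← inner_conj_symm, mul_left_comm, mul_comm ((starRingEnd ℂ) _),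
    Complex.mul_conj, Complex.normSq_eq_norm_sq, ← Complex.ofReal_mul, Complex.ofReal_re]

theorem norm_sq_eq_sum (b : OrthonormalBasis (Fin n) ℂ (EuclideanSpace ℂ (Fin n)))
    (x : EuclideanSpace ℂ (Fin n)) : ‖x‖ ^ 2 = ∑ i, ‖inner ℂ (b i) x‖ ^ 2 :=
  (b.sum_sq_norm_inner_right x).symm

/-- Every eigenvalue of a perturbed matrix is close to an eigenvalue of the unperturbed one. -/
theorem exists_eigenvalue_near (hb : ∀ i, act A (b i) = (s i : ℂ) • b i)
    (Δ : Matrix (Fin n) (Fin n) ℂ) {t : ℝ} {x : EuclideanSpace ℂ (Fin n)} (hx0 : x ≠ 0)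
    (hx : act (A + Δ) x = (t : ℂ) • x) : ∃ i, |s i - t| ≤ specNorm Δ := by
  by_contra! hlt
  have hΔ : act Δ x = (t : ℂ) • x - act A x := by
    rw [← hx, act_add_left, add_sub_cancel_left]
  have hcoef : ∀ i, ‖inner ℂ (b i) (act Δ x)‖ = |s i - t| * ‖inner ℂ (b i) x‖ := by
    intro i
    rw [hΔ, inner_sub_right, inner_smul_right, inner_eigenvector_act hb, ← sub_mul, norm_mul,
      ← Complex.ofReal_sub, Complex.norm_real, Real.norm_eq_abs, abs_sub_comm]
  have h1 : ‖act Δ x‖ ^ 2 ≤ (specNorm Δ * ‖x‖) ^ 2 := by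
    gcongr; exact norm_act_le Δ x
  rw [mul_pow, norm_sq_eq_sum b, norm_sq_eq_sum b x, Finset.mul_sum] at h1
  -- In the eigenbasis, `Δx = (t - A)x` would be strictly longer than `‖Δ‖ ‖x‖`.
  refine absurd h1 (not_le.2 (Finset.sum_lt_sum (fun i _ => ?_) ?_))
  · rw [hcoef, mul_pow]
    have := specNorm_nonneg Δ
    have := (hlt i).le
    gcongr
  · have : ∃ i, inner ℂ (b i) x ≠ 0 := by
      by_contra! h
      refine hx0 (norm_eq_zero.1 ?_)
      have h2 := norm_sq_eq_sum b x
      simp [h] at h2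
      simp [h2]
    obtain ⟨i, hi⟩ := this
    refine ⟨i, Finset.mem_univ _, ?_⟩
    rw [hcoef, mul_pow]
    have := specNorm_nonneg Δ
    have := hlt i
    have : 0 < ‖inner ℂ (b i) x‖ := norm_pos_iff.2 hi
    gcongr

theorem eigenvector_mem_keptSpace (hb : ∀ i, act A (b i) = (s i : ℂ) • b i) {ε : ℝ} {i : Fin n}
    (hi : ε < s i) : b i ∈ keptSpace A ε :=
  Submodule.subset_span ⟨s i, hi, hb i⟩

theorem inner_eigenvector_eq_zero_of_mem_keptSpace (hb : ∀ i, act A (b i) = (s i : ℂ) • b i)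
    {ε : ℝ} {i : Fin n} (hi : s i ≤ ε) {x : EuclideanSpace ℂ (Fin n)} (hx : x ∈ keptSpace A ε) :
    inner ℂ (b i) x = 0 := by
  induction hx using Submodule.span_induction with
  | mem x hx =>
    obtain ⟨t, ht, hxt⟩ := hx
    have h := inner_eigenvector_act hb i x
    rw [hxt, inner_smul_right, ← sub_eq_zero, ← sub_mul, mul_eq_zero] at h
    refine h.resolve_left ?_
    rw [← Complex.ofReal_sub, Complex.ofReal_eq_zero]
    linarith
  | zero => simp
  | add x y _ _ hx hy => rw [inner_add_right, hx, hy, add_zero]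
  | smul c x _ hx => rw [inner_smul_right, hx, mul_zero]

theorem le_quadForm_of_mem_keptSpace (hb : ∀ i, act A (b i) = (s i : ℂ) • b i) {ε : ℝ}
    {x : EuclideanSpace ℂ (Fin n)} (hx : x ∈ keptSpace A ε) :
    ε * ‖x‖ ^ 2 ≤ quadForm A x := by
  rw [quadForm_eq_sum hb, norm_sq_eq_sum b, Finset.mul_sum]
  refine Finset.sum_le_sum fun i _ => ?_
  rcases le_or_gt (s i) ε with hi | hi
  · simp [inner_eigenvector_eq_zero_of_mem_keptSpace hb hi hx]
  · gcongr

/-- The bound `β` is left free so that it can be the threshold itself, the finer bound through the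
discarded eigenvalues, or zero when only the kernel is discarded. -/
theorem quadForm_le_of_orthogonal_keptSpace (hb : ∀ i, act A (b i) = (s i : ℂ) • b i) {ε β : ℝ}
    (hβ : ∀ i, s i ≤ ε → s i ≤ β) {x : EuclideanSpace ℂ (Fin n)} (hx : x ∈ (keptSpace A ε)ᗮ) :
    quadForm A x ≤ β * ‖x‖ ^ 2 := by
  rw [quadForm_eq_sum hb, norm_sq_eq_sum b, Finset.mul_sum]
  refine Finset.sum_le_sum fun i _ => ?_
  rcases le_or_gt (s i) ε with hi | hi
  · have := hβ i hi
    gcongr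
  · have := (Submodule.mem_orthogonal _ _).1 hx _ (eigenvector_mem_keptSpace hb hi)
    simp [this]

end Eigenbasis

theorem act_eigenvectorBasis {n : ℕ} {A : Matrix (Fin n) (Fin n) ℂ} (hA : A.IsHermitian)
    (i : Fin n) :
    act A (hA.eigenvectorBasis i) = (hA.eigenvalues i : ℂ) • hA.eigenvectorBasis i := by
  ext j
  have h := congrFun (hA.mulVec_eigenvectorBasis i) j
  simpa [act, Matrix.toEuclideanLin, Matrix.toLpLin_apply] using h

/-- If the pencil is definite on the kept space then the regularized problem has a lowest
eigenvalue, the least value of the generalized Rayleigh quotient on the kept space. -/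
theorem exists_isLowest {n : ℕ} {A B : Matrix (Fin n) (Fin n) ℂ} (hA : A.IsHermitian)
    (hB : B.IsHermitian) {ε : ℝ} (hε : 0 < ε) (hK : keptSpace B ε ≠ ⊥) :
    ∃ F, IsLowest A B ε F ∧ (∀ x ∈ keptSpace B ε, F * quadForm B x ≤ quadForm A x) ∧
      ∃ x ∈ keptSpace B ε, x ≠ 0 ∧ quadForm A x = F * quadForm B x := by
  have hpos : ∀ x ∈ keptSpace B ε, x ≠ 0 → 0 < quadForm B x := by
    intro x hx hx0
    have := le_quadForm_of_mem_keptSpace (act_eigenvectorBasis hB) hx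
    have h2 : 0 < ‖x‖ := norm_pos_iff.2 hx0
    have : 0 < ε * ‖x‖ ^ 2 := by positivity
    linarith
  obtain ⟨F, hle, x, hx, hx0, hxq, hxe⟩ := exists_lowest_pencil_eigenvalue hA hB hK hpos
  refine ⟨F, ⟨⟨x, hx, hx0, hxe⟩, ?_⟩, hle, x, hx, hx0, hxq⟩
  rintro G ⟨y, hy, hy0, hye⟩
  have h := hye y hy
  rw [inner_act_self hA, inner_act_self hB, ← Complex.ofReal_mul, Complex.ofReal_inj] at h
  have := hle y hy
  rw [h] at this
  exact le_of_mul_le_mul_right this (hpos y hy hy0)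

/-! ### The Krylov map and its Gram matrices -/

/-- The linear combination of the Krylov vectors with given coefficients. -/
def krylovMap {N : ℕ} (H : Matrix (Fin N) (Fin N) ℂ) (ψ₀ : EuclideanSpace ℂ (Fin N)) (D : ℕ) :
    EuclideanSpace ℂ (Fin D) →ₗ[ℂ] EuclideanSpace ℂ (Fin N) where
  toFun c := ∑ k, c k • krylovVec H ψ₀ k
  map_add' c d := by simp [add_smul, Finset.sum_add_distrib]
  map_smul' r c := by simp [Finset.smul_sum, mul_smul]

theorem krylovMap_apply {N : ℕ} (H : Matrix (Fin N) (Fin N) ℂ) (ψ₀ : EuclideanSpace ℂ (Fin N))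
    {D : ℕ} (c : EuclideanSpace ℂ (Fin D)) :
    krylovMap H ψ₀ D c = ∑ k, c k • krylovVec H ψ₀ k := rfl

theorem act_apply {n : ℕ} (A : Matrix (Fin n) (Fin n) ℂ) (x : EuclideanSpace ℂ (Fin n))
    (i : Fin n) : act A x i = ∑ j, A i j * x j := by
  simp [act, Matrix.toEuclideanLin, Matrix.toLpLin_apply, Matrix.mulVec, dotProduct]

/-- The sesquilinear form of a matrix of inner products. -/
theorem inner_act_of_inner {N D : ℕ} (f g : Fin D → EuclideanSpace ℂ (Fin N))
    (x y : EuclideanSpace ℂ (Fin D)) :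
    inner ℂ y (act (Matrix.of fun i j => inner ℂ (f i) (g j)) x) =
      inner ℂ (∑ i, y i • f i) (∑ j, x j • g j) := by
  rw [PiLp.inner_apply, sum_inner]
  refine Finset.sum_congr rfl fun i _ => ?_
  rw [act_apply, inner_sum, inner_sum]
  refine Finset.sum_congr rfl fun j _ => ?_
  rw [Matrix.of_apply, inner_smul_left, inner_smul_right, RCLike.inner_apply]
  ring

section Krylov

variable {N : ℕ} {H : Matrix (Fin N) (Fin N) ℂ} {ψ₀ : EuclideanSpace ℂ (Fin N)} {D : ℕ}

theorem inner_act_overlapMatrix (x y : EuclideanSpace ℂ (Fin D)) :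
    inner ℂ y (act (overlapMatrix H ψ₀ D) x) =
      inner ℂ (krylovMap H ψ₀ D y) (krylovMap H ψ₀ D x) :=
  inner_act_of_inner _ _ x y

theorem inner_act_projectedMatrix (x y : EuclideanSpace ℂ (Fin D)) :
    inner ℂ y (act (projectedMatrix H ψ₀ D) x) =
      inner ℂ (krylovMap H ψ₀ D y) (act H (krylovMap H ψ₀ D x)) := by
  refine (inner_act_of_inner _ _ x y).trans ?_
  rw [krylovMap_apply, krylovMap_apply]
  simp only [act, map_sum, map_smul]

theorem quadForm_overlapMatrix (x : EuclideanSpace ℂ (Fin D)) :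
    quadForm (overlapMatrix H ψ₀ D) x = ‖krylovMap H ψ₀ D x‖ ^ 2 := by
  rw [quadForm, inner_act_overlapMatrix, inner_self_eq_norm_sq_to_K, ← RCLike.ofReal_pow]
  exact Complex.ofReal_re _

theorem quadForm_projectedMatrix (x : EuclideanSpace ℂ (Fin D)) :
    quadForm (projectedMatrix H ψ₀ D) x = quadForm H (krylovMap H ψ₀ D x) := by
  rw [quadForm, inner_act_projectedMatrix, quadForm]

theorem isHermitian_overlapMatrix : (overlapMatrix H ψ₀ D).IsHermitian := by
  ext i j
  simp only [Matrix.conjTranspose_apply, overlapMatrix, Matrix.of_apply]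
  exact inner_conj_symm _ _

theorem isHermitian_projectedMatrix (hH : H.IsHermitian) :
    (projectedMatrix H ψ₀ D).IsHermitian := by
  ext i j
  simp only [Matrix.conjTranspose_apply, projectedMatrix, Matrix.of_apply]
  rw [← inner_act_left hH]
  exact inner_conj_symm _ _

theorem krylovVec_zero : krylovVec H ψ₀ 0 = ψ₀ := by
  simp [krylovVec, act, Matrix.toEuclideanLin]

theorem krylovVec_one : krylovVec H ψ₀ 1 = act H ψ₀ := by
  simp [krylovVec]

theorem krylovVec_add_two (k : ℕ) :
    krylovVec H ψ₀ (k + 2) = (2 : ℂ) • act H (krylovVec H ψ₀ (k + 1)) - krylovVec H ψ₀ k := by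
  simp only [krylovVec]
  push_cast
  rw [Polynomial.Chebyshev.T_add_two, map_sub, map_mul, map_mul, Polynomial.aeval_X, ← act_mul]
  simp only [act, map_sub, LinearMap.sub_apply, map_ofNat, mul_assoc]
  congr 1
  rw [show (2 : Matrix (Fin N) (Fin N) ℂ) = (2 : ℂ) • 1 by
    rw [← Algebra.algebraMap_eq_smul_one, map_ofNat], smul_one_mul, map_smul,
    LinearMap.smul_apply]

theorem inner_eigenvector_krylovVec {E : Fin N → ℝ}
    {φ : OrthonormalBasis (Fin N) ℂ (EuclideanSpace ℂ (Fin N))}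
    (hφ : ∀ i, act H (φ i) = (E i : ℂ) • φ i) (i : Fin N) (k : ℕ) :
    inner ℂ (φ i) (krylovVec H ψ₀ k) =
      (((Polynomial.Chebyshev.T ℝ (k : ℤ)).eval (E i) : ℝ) : ℂ) * inner ℂ (φ i) ψ₀ := by
  induction k using Nat.twoStepInduction with
  | zero => simp [krylovVec_zero]
  | one => simp [krylovVec_one, inner_eigenvector_act hφ]
  | more k h0 h1 =>
    rw [krylovVec_add_two, inner_sub_right, inner_smul_right, inner_eigenvector_act hφ, h0, h1]
    push_cast
    rw [Polynomial.Chebyshev.T_add_two]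
    simp
    ring

theorem inner_eigenvector_krylovMap {E : Fin N → ℝ}
    {φ : OrthonormalBasis (Fin N) ℂ (EuclideanSpace ℂ (Fin N))}
    (hφ : ∀ i, act H (φ i) = (E i : ℂ) • φ i) (i : Fin N) (c : Fin D → ℝ) :
    inner ℂ (φ i) (krylovMap H ψ₀ D (WithLp.toLp 2 fun k => (c k : ℂ))) =
      ((∑ k, c k * (Polynomial.Chebyshev.T ℝ ((k : ℕ) : ℤ)).eval (E i) : ℝ) : ℂ) *
        inner ℂ (φ i) ψ₀ := by
  rw [krylovMap_apply, inner_sum]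
  simp only [inner_smul_right, inner_eigenvector_krylovVec hφ, Complex.ofReal_sum,
    Complex.ofReal_mul, Finset.sum_mul, mul_assoc]

theorem krylovMap_single (k : Fin D) :
    krylovMap H ψ₀ D (EuclideanSpace.single k 1) = krylovVec H ψ₀ k := by
  rw [krylovMap_apply, Finset.sum_eq_single k]
  · simp
  · intro j _ hj; simp [hj]
  · simp

/-- The compression of `H` to a Krylov space has no eigenvector orthogonal to the reference
state. -/
theorem krylovMap_eq_zero_of_compression_eigenvector (hH : H.IsHermitian) {F : ℝ}
    {x : EuclideanSpace ℂ (Fin D)}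
    (hx : ∀ y, inner ℂ (krylovMap H ψ₀ D y) (act H (krylovMap H ψ₀ D x)) =
      (F : ℂ) * inner ℂ (krylovMap H ψ₀ D y) (krylovMap H ψ₀ D x))
    (h0 : inner ℂ ψ₀ (krylovMap H ψ₀ D x) = 0) : krylovMap H ψ₀ D x = 0 := by
  set u := krylovMap H ψ₀ D x with hu
  have hvec : ∀ k < D, inner ℂ (act H (krylovVec H ψ₀ k)) u =
      (F : ℂ) * inner ℂ (krylovVec H ψ₀ k) u := by
    intro k hk
    have h := hx (EuclideanSpace.single ⟨k, hk⟩ 1)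
    rw [krylovMap_single] at h
    rw [inner_act_left hH, h]
  -- Pairing the three-term recurrence with `u` turns `H` into the scalar `F`, so two vanishing
  -- overlaps propagate to all Krylov vectors, whose span contains `u`.
  have hzero : ∀ k, k < D → inner ℂ (krylovVec H ψ₀ k) u = 0 := by
    intro k
    induction k using Nat.twoStepInduction with
    | zero => intro _; rw [krylovVec_zero, h0]
    | one =>
      intro hk
      have := hvec 0 (by omega)
      rw [krylovVec_zero, h0, mul_zero] at this
      rw [krylovVec_one, this]
    | more k ih0 ih1 =>
      intro hk
      rw [krylovVec_add_two, inner_sub_left, inner_smul_left, hvec _ (by omega),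
        ih1 (by omega), ih0 (by omega)]
      simp
  have : inner ℂ u u = 0 := by
    conv_lhs => rw [hu, krylovMap_apply, sum_inner]
    refine Finset.sum_eq_zero fun k _ => ?_
    rw [inner_smul_left, ← krylovMap_apply, ← hu, hzero k k.2, mul_zero]
  exact inner_self_eq_zero.1 this

end Krylov

/-! ### Excess energy above the ground level -/

section Excess

variable {N : ℕ} {H : Matrix (Fin N) (Fin N) ℂ} {E : Fin N → ℝ}
  {φ : OrthonormalBasis (Fin N) ℂ (EuclideanSpace ℂ (Fin N))}

theorem quadForm_sub_eq_sum (hφ : ∀ i, act H (φ i) = (E i : ℂ) • φ i) (e : ℝ)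
    (x : EuclideanSpace ℂ (Fin N)) :
    quadForm H x - e * ‖x‖ ^ 2 = ∑ i, (E i - e) * ‖inner ℂ (φ i) x‖ ^ 2 := by
  rw [quadForm_eq_sum hφ, norm_sq_eq_sum φ, Finset.mul_sum, ← Finset.sum_sub_distrib]
  exact Finset.sum_congr rfl fun i _ => by ring

theorem le_quadForm_of_forall_le (hφ : ∀ i, act H (φ i) = (E i : ℂ) • φ i) {e : ℝ}
    (he : ∀ i, e ≤ E i) (x : EuclideanSpace ℂ (Fin N)) : e * ‖x‖ ^ 2 ≤ quadForm H x := by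
  have : 0 ≤ quadForm H x - e * ‖x‖ ^ 2 := by
    rw [quadForm_sub_eq_sum hφ]
    exact Finset.sum_nonneg fun i _ => mul_nonneg (sub_nonneg.2 (he i)) (sq_nonneg _)
  linarith

theorem quadForm_sub_le (hφ : ∀ i, act H (φ i) = (E i : ℂ) • φ i) {e M : ℝ}
    (hM : ∀ i, E i - e ≤ M) (x : EuclideanSpace ℂ (Fin N)) :
    quadForm H x - e * ‖x‖ ^ 2 ≤ M * ‖x‖ ^ 2 := by
  rw [quadForm_sub_eq_sum hφ, norm_sq_eq_sum φ, Finset.mul_sum]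
  exact Finset.sum_le_sum fun i _ => by have := hM i; gcongr

/-- `H - e` is positive semidefinite, so its form obeys the parallelogram inequality. This separates
the filtered state from the part lost by projection. -/
theorem quadForm_sub_sub_le (hφ : ∀ i, act H (φ i) = (E i : ℂ) • φ i) {e : ℝ}
    (he : ∀ i, e ≤ E i) (x y : EuclideanSpace ℂ (Fin N)) :
    quadForm H (x - y) - e * ‖x - y‖ ^ 2 ≤
      2 * (quadForm H x - e * ‖x‖ ^ 2) + 2 * (quadForm H y - e * ‖y‖ ^ 2) := by
  simp only [quadForm_sub_eq_sum hφ, Finset.mul_sum, ← Finset.sum_add_distrib]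
  refine Finset.sum_le_sum fun i _ => ?_
  rw [inner_sub_right]
  have h := norm_sub_le (inner ℂ (φ i) x) (inner ℂ (φ i) y)
  have h1 : ‖inner ℂ (φ i) x - inner ℂ (φ i) y‖ ^ 2 ≤
      2 * ‖inner ℂ (φ i) x‖ ^ 2 + 2 * ‖inner ℂ (φ i) y‖ ^ 2 := by
    nlinarith [norm_nonneg (inner ℂ (φ i) x - inner ℂ (φ i) y),
      sq_nonneg (‖inner ℂ (φ i) x‖ - ‖inner ℂ (φ i) y‖)]
  have := mul_le_mul_of_nonneg_left h1 (sub_nonneg.2 (he i))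
  linarith

/-- Excess energy of a filtered reference state. -/
theorem quadForm_krylovMap_sub_le (hφ : ∀ i, act H (φ i) = (E i : ℂ) • φ i) {e δ τ : ℝ}
    (he : ∀ i, e ≤ E i) (hE : ∀ i, E i - e ≤ 2) {ψ₀ : EuclideanSpace ℂ (Fin N)} (hψ : ‖ψ₀‖ = 1)
    (hδ : 0 ≤ δ) (hτ : 0 ≤ τ) {D : ℕ} (c : Fin D → ℝ)
    (hfar : ∀ i, δ ≤ |E i - e| →
      (∑ k, c k * (Polynomial.Chebyshev.T ℝ ((k : ℕ) : ℤ)).eval (E i)) ^ 2 ≤ τ) :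
    let u := krylovMap H ψ₀ D (WithLp.toLp 2 fun k => (c k : ℂ))
    quadForm H u - e * ‖u‖ ^ 2 ≤ δ * ‖u‖ ^ 2 + 2 * τ := by
  intro u
  have h1 : 2 * τ = ∑ i, 2 * τ * ‖inner ℂ (φ i) ψ₀‖ ^ 2 := by
    rw [← Finset.mul_sum, ← norm_sq_eq_sum φ, hψ]; ring
  rw [quadForm_sub_eq_sum hφ, norm_sq_eq_sum φ, Finset.mul_sum, h1, ← Finset.sum_add_distrib]
  refine Finset.sum_le_sum fun i _ => ?_
  have h0 := sub_nonneg.2 (he i)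
  -- Levels within `δ` cost at most `δ` times their weight; higher levels cost at most `2` and are
  -- damped by `τ`.
  rcases le_or_gt δ (E i - e) with h | h
  · have hp := hfar i (by rwa [abs_of_nonneg h0])
    have h2 : ‖inner ℂ (φ i) u‖ ^ 2 ≤ τ * ‖inner ℂ (φ i) ψ₀‖ ^ 2 := by
      rw [inner_eigenvector_krylovMap hφ, norm_mul, mul_pow, Complex.norm_real,
        Real.norm_eq_abs, sq_abs]
      gcongr
    have h3 : (E i - e) * ‖inner ℂ (φ i) u‖ ^ 2 ≤ 2 * (τ * ‖inner ℂ (φ i) ψ₀‖ ^ 2) :=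
      mul_le_mul (hE i) h2 (by positivity) (by norm_num)
    have : 0 ≤ δ * ‖inner ℂ (φ i) u‖ ^ 2 := by positivity
    linarith
  · have h3 : (E i - e) * ‖inner ℂ (φ i) u‖ ^ 2 ≤ δ * ‖inner ℂ (φ i) u‖ ^ 2 := by gcongr
    have : 0 ≤ 2 * τ * ‖inner ℂ (φ i) ψ₀‖ ^ 2 := by positivity
    linarith

end Excess

/-! ### Loss under projection onto the noisy kept space -/

section Projection

variable {D N : ℕ} {S Δ : Matrix (Fin D) (Fin D) ℂ} {ε σ g : ℝ}

/-- What thresholding of a perturbed Gram matrix discards is small. -/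
theorem exists_mem_keptSpace_of_norm_sq_le_two
    {V : EuclideanSpace ℂ (Fin D) →ₗ[ℂ] EuclideanSpace ℂ (Fin N)}
    (hV : ∀ x, quadForm S x = ‖V x‖ ^ 2) (hS : S.IsHermitian) (hΔ : Δ.IsHermitian)
    (hD : 1 ≤ D) (hε : 0 < ε) (hεg : 4 * D * ε ≤ g ^ 2) (hg : 0 < g) (hη : 6 * specNorm Δ ≤ ε)
    (hσ : ∀ t x, x ≠ 0 → act (S + Δ) x = ((t : ℝ) : ℂ) • x → t ≤ ε → t ≤ σ + specNorm Δ)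
    (hσ0 : 0 ≤ σ)
    {c : EuclideanSpace ℂ (Fin D)} (hc : ‖c‖ ^ 2 ≤ 2) (hVc : g ≤ ‖V c‖) :
    ∃ x ∈ keptSpace (S + Δ) ε, ‖V c‖ ≤ 5 * ‖V x‖ ∧
      ‖V (c - x)‖ ^ 2 ≤ (σ + 2 * specNorm Δ) * ‖c‖ ^ 2 := by
  have hH := hS.add hΔ
  have hb := act_eigenvectorBasis hH
  set K := keptSpace (S + Δ) ε
  set x := K.starProjection c with hx
  have hw : c - x ∈ Kᗮ := Submodule.sub_starProjection_mem_orthogonal c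
  have hnorm : ‖c - x‖ ≤ ‖c‖ := by
    have h := Submodule.norm_sq_eq_add_norm_sq_starProjection c K
    rw [Submodule.starProjection_orthogonal_val] at h
    rw [← hx] at h
    exact le_of_sq_le_sq (by nlinarith [sq_nonneg ‖x‖]) (norm_nonneg _)
  have hnorm2 : ‖c - x‖ ^ 2 ≤ ‖c‖ ^ 2 := by gcongr
  have hη0 := specNorm_nonneg Δ
  -- Used twice: `β = ε` keeps a fixed fraction of `Vc`, and `β = σ + ‖Δ‖` measures the leakage.
  have key : ∀ β, 0 ≤ β → (∀ i, hH.eigenvalues i ≤ ε → hH.eigenvalues i ≤ β) →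
      ‖V (c - x)‖ ^ 2 ≤ (β + specNorm Δ) * ‖c‖ ^ 2 := by
    intro β hβ0 hβ
    have h1 := quadForm_le_of_orthogonal_keptSpace hb hβ hw
    have h2 := abs_le.1 (abs_quadForm_le Δ (c - x))
    rw [quadForm_add_left, hV] at h1
    calc ‖V (c - x)‖ ^ 2 ≤ (β + specNorm Δ) * ‖c - x‖ ^ 2 := by linarith [h2.1]
      _ ≤ _ := by gcongr
  have h1 := key ε hε.le fun i hi => hi
  have h2 := key (σ + specNorm Δ) (by positivity) fun i hi =>
    hσ _ _ (by simpa using hH.eigenvectorBasis.toBasis.ne_zero i) (hb i) hi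
  refine ⟨x, Submodule.starProjection_apply_mem K c, ?_, by linarith⟩
  have hD' : (1 : ℝ) ≤ D := by exact_mod_cast hD
  have h4ε : 4 * ε ≤ g ^ 2 := by nlinarith
  -- The loss is at most `2(ε + ε/6) = 7ε/3 ≤ 7g²/12`, below `16g²/25`.
  have h3 : ‖V (c - x)‖ ^ 2 ≤ (4 / 5 * ‖V c‖) ^ 2 := by
    have : g ^ 2 ≤ ‖V c‖ ^ 2 := by gcongr
    have : (ε + specNorm Δ) * ‖c‖ ^ 2 ≤ (ε + specNorm Δ) * 2 := by gcongr
    nlinarith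
  have h4 := le_of_sq_le_sq h3 (by positivity)
  have h5 : ‖V c‖ ≤ ‖V x‖ + ‖V (c - x)‖ := by
    calc ‖V c‖ = ‖V x + V (c - x)‖ := by rw [← map_add, add_sub_cancel]
      _ ≤ _ := norm_add_le _ _
  linarith

end Projection

/-! ### The energy bound up to `O(1/D)` -/

set_option maxHeartbeats 400000 in
open Polynomial.Chebyshev in
/-- The estimate of the lowest energy from a noisy thresholded Krylov pencil, up to an additive
error of order `1 / D`. -/
theorem exists_isLowest_abs_sub_le {N : ℕ} {H : Matrix (Fin N) (Fin N) ℂ} (hH : H.IsHermitian)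
    {E : Fin N → ℝ} {φ : OrthonormalBasis (Fin N) ℂ (EuclideanSpace ℂ (Fin N))}
    (hφ : ∀ i, act H (φ i) = (E i : ℂ) • φ i) (hE : ∀ i, E i ∈ Set.Icc (-1 : ℝ) 1)
    {i₀ : Fin N} (hE0 : ∀ i, E i₀ ≤ E i)
    {ψ₀ : EuclideanSpace ℂ (Fin N)} (hψ : ‖ψ₀‖ = 1) {g : ℝ} (hg : g = ‖inner ℂ (φ i₀) ψ₀‖)
    (hg0 : 0 < g) {D : ℕ} (hD : 1 ≤ D) {ΔH ΔS : Matrix (Fin D) (Fin D) ℂ}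
    (hΔH : ΔH.IsHermitian) (hΔS : ΔS.IsHermitian) {ε σ : ℝ} (hε : 0 < ε)
    (hεg : 4 * D * ε ≤ g ^ 2)
    (hη : (D : ℝ) ^ 4 * (6 * specNorm ΔS + specNorm ΔH) ≤ ε)
    (hσ : ∀ t x, x ≠ 0 → act (overlapMatrix H ψ₀ D + ΔS) x = ((t : ℝ) : ℂ) • x → t ≤ ε →
      t ≤ σ + specNorm ΔS) (hσ0 : 0 ≤ σ) (hσD : σ ≤ D * ε) :
    ∃ E', IsLowest (projectedMatrix H ψ₀ D + ΔH) (overlapMatrix H ψ₀ D + ΔS) ε E' ∧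
      ∀ δ > 0, |E' - E i₀| ≤
        4800 * (√δ * σ / g ^ 2 + δ + 1 / g ^ 2 * ((1 + δ / 2) ^ D)⁻¹) + 401 / D := by
  have hD' : (1 : ℝ) ≤ D := by exact_mod_cast hD
  have hS0 := specNorm_nonneg ΔS
  have hH0 := specNorm_nonneg ΔH
  set ηS := specNorm ΔS with hηS
  set ηH := specNorm ΔH with hηH
  have hη6 : 6 * ηS + ηH ≤ ε / D := by
    rw [le_div_iff₀ (by linarith)]
    refine le_trans ?_ hη
    rw [mul_comm]
    gcongr
    exact le_self_pow₀ hD' (by norm_num)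
  have hεD : ε / D ≤ ε := div_le_self hε.le hD'
  set V := krylovMap H ψ₀ D with hV
  set S := overlapMatrix H ψ₀ D with hSdef
  have hqS : ∀ x, quadForm S x = ‖V x‖ ^ 2 := quadForm_overlapMatrix
  have hSh : S.IsHermitian := isHermitian_overlapMatrix
  have hPh := isHermitian_projectedMatrix (ψ₀ := ψ₀) (D := D) hH
  have hi0 := hE i₀
  have hgap : ∀ i, E i - E i₀ ≤ 2 := fun i => by linarith [(hE i).2, hi0.1]
  have he1 : |E i₀| ≤ 1 := abs_le.2 hi0
  -- coefficient vectors
  have hcoef : ∀ c : Fin D → ℝ, (∑ k, c k * (T ℝ ((k : ℕ) : ℤ)).eval (E i₀) = 1) →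
      (∀ x ∈ Set.Icc (-1 : ℝ) 1, |∑ k, c k * (T ℝ ((k : ℕ) : ℤ)).eval x| ≤ 1) →
      ‖(WithLp.toLp 2 fun k => (c k : ℂ) : EuclideanSpace ℂ (Fin D))‖ ^ 2 = ∑ k, c k ^ 2 ∧
      ∑ k, c k ^ 2 ≤ 2 ∧ g ≤ ‖V (WithLp.toLp 2 fun k => (c k : ℂ))‖ := by
    intro c hc1 hc2
    refine ⟨by simp [EuclideanSpace.norm_sq_eq], ?_, ?_⟩
    -- The peak estimate with `δ = 0` and `τ = 1` is just Bessel's inequality for `|p| ≤ 1`.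
    · have := sum_sq_chebyshev_coeff_le_of_peak c hi0 le_rfl zero_le_one hc2
        fun x hx _ => (sq_le_one_iff_abs_le_one _).2 (hc2 x hx)
      simpa using this
    · have h1 : ‖inner ℂ (φ i₀) (V (WithLp.toLp 2 fun k => (c k : ℂ)))‖ = g := by
        rw [inner_eigenvector_krylovMap hφ, hc1, hg]; simp
      rw [← h1]
      refine (norm_inner_le_norm _ _).trans_eq ?_
      rw [φ.norm_eq_one, one_mul]
  have hproj := fun (c : EuclideanSpace ℂ (Fin D)) (hc : ‖c‖ ^ 2 ≤ 2) (hVc : g ≤ ‖V c‖) =>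
    exists_mem_keptSpace_of_norm_sq_le_two hqS hSh hΔS hD hε hεg hg0 (by linarith) hσ hσ0 hc hVc
  -- the kept space is nonzero
  have hK : ∃ x ∈ keptSpace (S + ΔS) ε, 0 < ‖V x‖ := by
    obtain ⟨c, hc1, hc2, -⟩ := exists_chebyshev_filter hD hi0 (δ := 1 / 2) (by norm_num)
      (by norm_num)
    obtain ⟨h1, h2, h3⟩ := hcoef c hc1 hc2
    obtain ⟨x, hx, hx1, -⟩ := hproj _ (h1.trans_le h2) h3
    exact ⟨x, hx, by linarith⟩
  obtain ⟨y, hy, hy0⟩ := hK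
  have hKne : keptSpace (S + ΔS) ε ≠ ⊥ := by
    rw [Submodule.ne_bot_iff]
    refine ⟨y, hy, ?_⟩
    rintro rfl
    simp at hy0
  obtain ⟨E', hlow, hle, z, hz, hz0, hzq⟩ :=
    exists_isLowest (hPh.add hΔH) (hSh.add hΔS) hε hKne
  -- noise in the quadratic forms on the kept space
  have hQ : ∀ x ∈ keptSpace (S + ΔS) ε,
      ‖V x‖ ^ 2 ≤ 2 * quadForm (S + ΔS) x ∧
      |quadForm (projectedMatrix H ψ₀ D + ΔH) x - E i₀ * quadForm (S + ΔS) x -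
        (quadForm H (V x) - E i₀ * ‖V x‖ ^ 2)| ≤ 1 / D * quadForm (S + ΔS) x := by
    intro x hx
    have h1 := le_quadForm_of_mem_keptSpace (act_eigenvectorBasis (hSh.add hΔS)) hx
    have h2 := abs_quadForm_le ΔS x
    have h3 := abs_quadForm_le ΔH x
    have h4 : quadForm (S + ΔS) x = ‖V x‖ ^ 2 + quadForm ΔS x := by
      rw [quadForm_add_left, hqS]
    have h5 : quadForm (projectedMatrix H ψ₀ D + ΔH) x = quadForm H (V x) + quadForm ΔH x := by
      rw [quadForm_add_left, quadForm_projectedMatrix]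
    have hx2 := sq_nonneg ‖x‖
    constructor
    · have h6 := (abs_le.1 h2).1
      have h7 : ηS * ‖x‖ ^ 2 ≤ ε * ‖x‖ ^ 2 := by gcongr; linarith
      linarith
    · have h6 : quadForm (projectedMatrix H ψ₀ D + ΔH) x - E i₀ * quadForm (S + ΔS) x -
          (quadForm H (V x) - E i₀ * ‖V x‖ ^ 2) = quadForm ΔH x - E i₀ * quadForm ΔS x := by
        rw [h4, h5]; ring
      rw [h6]
      calc |quadForm ΔH x - E i₀ * quadForm ΔS x|
          ≤ |quadForm ΔH x| + |E i₀ * quadForm ΔS x| := abs_sub _ _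
        _ ≤ ηH * ‖x‖ ^ 2 + 1 * (ηS * ‖x‖ ^ 2) := by
            rw [abs_mul]; gcongr
        _ ≤ (ε / D) * ‖x‖ ^ 2 := by
            rw [one_mul, ← add_mul]
            gcongr
            linarith
        _ = 1 / D * (ε * ‖x‖ ^ 2) := by ring
        _ ≤ _ := by gcongr
  refine ⟨E', hlow, fun δ hδ => ?_⟩
  have hg2 : 0 < g ^ 2 := by positivity
  have hterm1 : 0 ≤ √δ * σ / g ^ 2 := by positivity
  have hterm3 : 0 ≤ 1 / g ^ 2 * ((1 + δ / 2) ^ D)⁻¹ := by positivity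
  have hinv : 0 < 1 / (D : ℝ) := by positivity
  -- The noiseless quotient never falls below the ground energy, so only noise can lower the
  -- estimate.
  have hlower : -(1 / (D : ℝ)) ≤ E' - E i₀ := by
    have h1 := le_quadForm_of_mem_keptSpace (act_eigenvectorBasis (hSh.add hΔS)) hz
    have hzp : 0 < quadForm (S + ΔS) z := by
      have : 0 < ‖z‖ := norm_pos_iff.2 hz0
      have : 0 < ε * ‖z‖ ^ 2 := by positivity
      linarith
    have h2 := (abs_le.1 (hQ z hz).2).1
    have h3 := le_quadForm_of_forall_le hφ hE0 (V z)
    rw [hzq] at h2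
    refine le_of_mul_le_mul_right ?_ hzp
    linarith
  have hupper : ∀ x ∈ keptSpace (S + ΔS) ε, 0 < ‖V x‖ → ∀ M,
      quadForm H (V x) - E i₀ * ‖V x‖ ^ 2 ≤ M * ‖V x‖ ^ 2 → 0 ≤ M →
      E' - E i₀ ≤ 2 * M + 1 / D := by
    intro x hx hx0 M hM hM0
    obtain ⟨h1, h2⟩ := hQ x hx
    have h3 := (abs_le.1 h2).2
    have h4 := hle x hx
    have hQp : 0 < quadForm (S + ΔS) x := by
      have : 0 < ‖V x‖ ^ 2 := by positivity
      linarith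
    have h5 : M * ‖V x‖ ^ 2 ≤ M * (2 * quadForm (S + ΔS) x) := by gcongr
    refine le_of_mul_le_mul_right ?_ hQp
    linarith
  have hfrac : 401 / (D : ℝ) = 401 * (1 / D) := by ring
  rw [abs_le]
  refine ⟨by rw [hfrac]; linarith, ?_⟩
  rcases le_or_gt 1 δ with h1δ | hδ1
  -- For `δ ≥ 1` any kept vector will do, since all energies lie within `2` of the ground energy.
  · have := hupper y hy hy0 2 (quadForm_sub_le hφ hgap _) (by norm_num)
    rw [hfrac]
    linarith
  obtain ⟨c, hc1, hc2, hc3⟩ := exists_chebyshev_filter hD hi0 hδ hδ1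
  obtain ⟨hcn, hcs, hVc⟩ := hcoef c hc1 hc2
  set τ : ℝ := 16 * ((1 + δ / 2) ^ D)⁻¹ with hτ
  have hτ0 : 0 ≤ τ := by positivity
  have hpeak := sum_sq_chebyshev_coeff_le_of_peak c hi0 hδ.le hτ0 hc2 hc3
  have hexc := quadForm_krylovMap_sub_le hφ hE0 hgap hψ hδ.le hτ0 c fun i => hc3 _ (hE i)
  simp only [← hV] at hexc
  set a : EuclideanSpace ℂ (Fin D) := WithLp.toLp 2 fun k => (c k : ℂ) with ha
  obtain ⟨x, hx, hx1, hx2⟩ := hproj a (hcn.trans_le hcs) hVc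
  have hVa2 : ‖V a‖ ^ 2 ≤ 25 * ‖V x‖ ^ 2 := by
    calc ‖V a‖ ^ 2 ≤ (5 * ‖V x‖) ^ 2 := by gcongr
      _ = 25 * ‖V x‖ ^ 2 := by ring
  have hgx : g ^ 2 ≤ 25 * ‖V x‖ ^ 2 := by
    refine le_trans ?_ hVa2
    gcongr
  -- The `√δ` part of `‖a‖²` meets `σ`. The `τ` part is absorbed by `σ ≤ Dε ≤ g²/4`, and the noise
  -- part by `6η_S ≤ ε/D`.
  have hleak : (σ + 2 * ηS) * ‖a‖ ^ 2 ≤ g ^ 2 * (4 * (√δ * σ / g ^ 2) + τ / 2 + 1 / D) := by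
    have e1 : σ * ‖a‖ ^ 2 ≤ σ * (4 * √δ + 2 * τ) := by
      rw [hcn]; gcongr
    have e2 : σ * τ ≤ g ^ 2 / 4 * τ := by
      have : σ ≤ g ^ 2 / 4 := by linarith
      gcongr
    have e3 : ηS * ‖a‖ ^ 2 ≤ ηS * 2 := by
      rw [hcn]; gcongr
    have e4 : 4 * ηS ≤ g ^ 2 * (1 / D) := by
      rw [mul_one_div]
      have : ε ≤ D * ε := le_mul_of_one_le_left hε.le hD'
      have : ε ≤ g ^ 2 := by linarith
      have : ε / D ≤ g ^ 2 / D := by gcongr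
      linarith
    have e5 : g ^ 2 * (4 * (√δ * σ / g ^ 2) + τ / 2 + 1 / D) =
        4 * √δ * σ + g ^ 2 * τ / 2 + g ^ 2 * (1 / D) := by
      field_simp
    rw [e5]
    linarith
  have hVX : V x = V a - V (a - x) := by rw [← map_sub, sub_sub_cancel]
  have hmain : quadForm H (V x) - E i₀ * ‖V x‖ ^ 2 ≤
      (50 * δ + 100 * τ / g ^ 2 + 100 * (4 * (√δ * σ / g ^ 2) + τ / 2 + 1 / D)) *
        ‖V x‖ ^ 2 := by
    have e1 := quadForm_sub_sub_le hφ hE0 (V a) (V (a - x))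
    rw [← hVX] at e1
    have e2 := quadForm_sub_le hφ hgap (V (a - x))
    have e3 : δ * ‖V a‖ ^ 2 ≤ δ * (25 * ‖V x‖ ^ 2) := by gcongr
    have e4 : τ ≤ τ / g ^ 2 * (25 * ‖V x‖ ^ 2) := by
      calc τ = τ / g ^ 2 * g ^ 2 := by field_simp
        _ ≤ _ := by gcongr
    have e5 := hx2.trans hleak
    have e6 : g ^ 2 * (4 * (√δ * σ / g ^ 2) + τ / 2 + 1 / D) ≤
        25 * ‖V x‖ ^ 2 * (4 * (√δ * σ / g ^ 2) + τ / 2 + 1 / D) := by gcongr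
    calc quadForm H (V x) - E i₀ * ‖V x‖ ^ 2
        ≤ 2 * (δ * (25 * ‖V x‖ ^ 2) + 2 * (τ / g ^ 2 * (25 * ‖V x‖ ^ 2))) +
          4 * (25 * ‖V x‖ ^ 2 * (4 * (√δ * σ / g ^ 2) + τ / 2 + 1 / D)) := by linarith
      _ = _ := by ring
  have hx0 : 0 < ‖V x‖ := by linarith
  have hfin := hupper x hx hx0 _ hmain (by positivity)
  have hg1 : g ≤ 1 := by
    rw [hg]
    refine (norm_inner_le_norm _ _).trans_eq ?_
    rw [φ.norm_eq_one, hψ, one_mul]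
  -- All multiples of `τ` add up to at most `300 τ/g²`, and `τ` carries a factor `16`: this is the
  -- constant `4800`.
  have hτg : τ ≤ τ / g ^ 2 := by
    rw [le_div_iff₀ hg2]
    exact mul_le_of_le_one_right hτ0 (pow_le_one₀ hg0.le hg1)
  have hτe : τ / g ^ 2 = 16 * (1 / g ^ 2 * ((1 + δ / 2) ^ D)⁻¹) := by rw [hτ]; ring
  have e7 : 100 * τ / g ^ 2 = 100 * (τ / g ^ 2) := by ring
  rw [e7] at hfin
  rw [hfrac]
  linarith

/-! ### Consequences of admissibility -/

/-- The error scale is never smaller than of order `1 / D`. -/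
theorem inv_le_two_mul_add_inv_pow {D : ℕ} (hD : 1 ≤ D) {g δ : ℝ} (hg0 : 0 < g) (hg1 : g ≤ 1)
    (hδ : 0 < δ) : 1 / (D : ℝ) ≤ 2 * (δ + 1 / g ^ 2 * ((1 + δ / 2) ^ D)⁻¹) := by
  have hD' : (1 : ℝ) ≤ D := by exact_mod_cast hD
  have hX : 0 < 1 / g ^ 2 * ((1 + δ / 2) ^ D)⁻¹ := by positivity
  -- Either `δ` alone suffices, or `δ < 1/D` and `(1 + δ/2)^D ≤ √e ≤ 2` stays bounded.
  rcases le_or_gt (1 / (D : ℝ)) δ with h | h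
  · linarith
  · have h1 : D * δ ≤ 1 := by
      rw [lt_div_iff₀ (by linarith)] at h
      linarith
    have h2 : (1 + δ / 2) ^ D ≤ 2 := by
      calc (1 + δ / 2) ^ D ≤ Real.exp (δ / 2) ^ D := by
            gcongr
            linarith [Real.add_one_le_exp (δ / 2)]
        _ = Real.exp (D * (δ / 2)) := (Real.exp_nat_mul _ _).symm
        _ ≤ Real.exp (1 / 2) := by
            gcongr
            linarith
        _ ≤ 2 := by
            have h4 : Real.exp (1 / 2) ^ 2 = Real.exp 1 := by
              rw [← Real.exp_nat_mul]; norm_num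
            nlinarith [Real.exp_one_lt_three, Real.exp_pos (1 / 2)]
    have h3 : (1 : ℝ) / 2 ≤ ((1 + δ / 2) ^ D)⁻¹ := by
      rw [one_div]
      exact inv_anti₀ (by positivity) h2
    have h4 : 1 ≤ 1 / g ^ 2 := by
      rw [le_div_iff₀ (by positivity), one_mul]
      exact pow_le_one₀ hg0.le hg1
    have h5 : 1 / (D : ℝ) ≤ 1 := by
      rw [div_le_one (by linarith)]; exact hD'
    nlinarith

/-- Extracts two facts from `chi`: the noise bound controls `6η_S + η_H`, and the factor `(s/ε)^α`
survives for the lower bound on the threshold. -/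
theorem add_le_chi {s α μ ρ ε ηH ηS : ℝ} (hs : ε ≤ s) (hε : 0 < ε) (hα : 0 ≤ α) (hμ : 0 < μ)
    (hρ : 0 < ρ) (hS : 0 ≤ ηS) :
    6 * (1 + 1 / ρ) * (s / ε) ^ α * ηS + ηH ≤ chi s α μ ρ ε ηH ηS ∧ 1 ≤ (s / ε) ^ α := by
  have h1 : 1 ≤ (s / ε) ^ α := Real.one_le_rpow ((one_le_div hε).2 hs) hα
  refine ⟨?_, h1⟩
  unfold chi
  have h2 : 0 < 1 / ρ := by positivity
  have : 6 * (1 + 1 / ρ) * (s / ε) ^ α * ηS ≤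
      3 * (2 + μ) * (1 + 1 / ρ) * (s / ε) ^ α * ηS := by
    gcongr
    linarith
  linarith

theorem eigenvalue_eq_norm_krylovMap {N D : ℕ} {H : Matrix (Fin N) (Fin N) ℂ}
    {ψ₀ : EuclideanSpace ℂ (Fin N)} {lam : Fin D → ℝ}
    {v : OrthonormalBasis (Fin D) ℂ (EuclideanSpace ℂ (Fin D))}
    (hv : ∀ i, act (overlapMatrix H ψ₀ D) (v i) = (lam i : ℂ) • v i) (i : Fin D) :
    ‖krylovMap H ψ₀ D (v i)‖ ^ 2 = lam i := by
  rw [← quadForm_overlapMatrix, quadForm, hv, inner_smul_right, v.inner_eq_one, mul_one,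
    Complex.ofReal_re]

/-- The first diagonal entry of `S` is `‖ψ₀‖² = 1`. -/
theorem one_le_specNorm_overlapMatrix {N D : ℕ} (H : Matrix (Fin N) (Fin N) ℂ)
    {ψ₀ : EuclideanSpace ℂ (Fin N)} (hψ : ‖ψ₀‖ = 1) (hD : 1 ≤ D) :
    1 ≤ specNorm (overlapMatrix H ψ₀ D) := by
  have h := abs_quadForm_le (overlapMatrix H ψ₀ D) (EuclideanSpace.single (⟨0, hD⟩ : Fin D) 1)
  rw [quadForm_overlapMatrix, krylovMap_single, krylovVec_zero, hψ] at h
  simpa using h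

theorem four_mul_le_of_admissible {D : ℕ} {A B : Matrix (Fin D) (Fin D) ℂ} {lam : Fin D → ℝ}
    {v : Fin D → EuclideanSpace ℂ (Fin D)} {g α ε ηH ηS : ℝ}
    (h : AdmissibleThreshold A B lam v g α ε ηH ηS) : 4 * D * ε ≤ g ^ 2 := by
  have h0 : 0 ≤ D * ε := mul_nonneg (Nat.cast_nonneg _) h.1.le
  have h1 := h.2.1
  have h2 := Real.sq_sqrt h0
  nlinarith [Real.sqrt_nonneg (D * ε)]

theorem le_one_of_admissible {D : ℕ} (hD : 1 ≤ D) {A B : Matrix (Fin D) (Fin D) ℂ}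
    {lam : Fin D → ℝ} {v : Fin D → EuclideanSpace ℂ (Fin D)} {g α ε ηH ηS : ℝ} (hg0 : 0 < g)
    (hg1 : g ≤ 1) (h : AdmissibleThreshold A B lam v g α ε ηH ηS) : ε ≤ 1 := by
  have h1 := four_mul_le_of_admissible h
  have h2 : g ^ 2 ≤ 1 := pow_le_one₀ hg0.le hg1
  have hD' : (1 : ℝ) ≤ D := by exact_mod_cast hD
  nlinarith [h.1]

/-- The energy estimate at an admissible threshold. -/
theorem exists_isLowest_abs_sub_le_of_admissible {N : ℕ} {H : Matrix (Fin N) (Fin N) ℂ}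
    (hH : H.IsHermitian) {E : Fin N → ℝ}
    {φ : OrthonormalBasis (Fin N) ℂ (EuclideanSpace ℂ (Fin N))}
    (hφ : ∀ i, act H (φ i) = (E i : ℂ) • φ i) (hE : ∀ i, E i ∈ Set.Icc (-1 : ℝ) 1)
    {i₀ : Fin N} (hE0 : ∀ i, E i₀ ≤ E i)
    {ψ₀ : EuclideanSpace ℂ (Fin N)} (hψ : ‖ψ₀‖ = 1) {g : ℝ} (hg : g = ‖inner ℂ (φ i₀) ψ₀‖)
    (hg0 : 0 < g) {D : ℕ} (hD : 1 ≤ D) {lam : Fin D → ℝ}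
    {v : OrthonormalBasis (Fin D) ℂ (EuclideanSpace ℂ (Fin D))}
    (hv : ∀ i, act (overlapMatrix H ψ₀ D) (v i) = (lam i : ℂ) • v i) {α : ℝ} (hα : 0 ≤ α)
    {ΔH ΔS : Matrix (Fin D) (Fin D) ℂ} (hΔH : ΔH.IsHermitian) (hΔS : ΔS.IsHermitian) {ε : ℝ}
    (hadm : AdmissibleThreshold (projectedMatrix H ψ₀ D) (overlapMatrix H ψ₀ D) lam v g α ε
      (specNorm ΔH) (specNorm ΔS)) :
    ∃ E', IsLowest (projectedMatrix H ψ₀ D + ΔH) (overlapMatrix H ψ₀ D + ΔS) ε E' ∧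
      ∀ δ > 0, |E' - E i₀| ≤
        6000 * errorScale D α (noiseRate ΔH ΔS) (discardedSum lam ε) g δ := by
  have hg1 : g ≤ 1 := by
    rw [hg]
    refine (norm_inner_le_norm _ _).trans_eq ?_
    rw [φ.norm_eq_one, hψ, one_mul]
  have hD' : (1 : ℝ) ≤ D := by exact_mod_cast hD
  have hD4 : (1 : ℝ) ≤ (D : ℝ) ^ 4 := one_le_pow₀ hD'
  have hεg := four_mul_le_of_admissible hadm
  have hε1 := le_one_of_admissible hD hg0 hg1 hadm
  obtain ⟨hε, -, μ, hμ, ρ, hρ, hN⟩ := hadm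
  have hS0 := specNorm_nonneg ΔS
  have hH0 := specNorm_nonneg ΔH
  set ηS := specNorm ΔS
  set ηH := specNorm ΔH
  obtain ⟨hchi, hpow⟩ := add_le_chi (ηH := ηH)
    (hε1.trans (one_le_specNorm_overlapMatrix H hψ hD)) hε hα hμ hρ hS0
  have hρ' : 0 < 1 / ρ := by positivity
  have hchi' : 6 * (1 + 1 / ρ) * ηS + ηH ≤
      chi (specNorm (overlapMatrix H ψ₀ D)) α μ ρ ε ηH ηS := by
    refine le_trans ?_ hchi
    have : 6 * (1 + 1 / ρ) * 1 * ηS ≤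
      6 * (1 + 1 / ρ) * (specNorm (overlapMatrix H ψ₀ D) / ε) ^ α * ηS := by gcongr
    linarith
  have hbound : (D : ℝ) ^ 4 * (6 * (1 + 1 / ρ) * ηS + ηH) ≤ ε :=
    (mul_le_mul_of_nonneg_left hchi' (by positivity)).trans hN.noise_bound
  have hη : (D : ℝ) ^ 4 * (6 * ηS + ηH) ≤ ε := by
    refine le_trans (mul_le_mul_of_nonneg_left ?_ (by positivity)) hbound
    have : 0 ≤ 1 / ρ * ηS := by positivity
    linarith
  -- The factor `1 + 1/ρ` in `chi` serves here: kept eigenvalues, at least `(1 + ρ)ε`, stay above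
  -- `ε` under noise.
  have hηρ : ηS < ρ * ε := by
    have h1 : 6 * (1 + 1 / ρ) * ηS ≤ ε := by
      have : 0 ≤ 6 * (1 + 1 / ρ) * ηS + ηH := by positivity
      nlinarith
    have h2 : 6 * (ρ + 1) * ηS ≤ ρ * ε := by
      calc 6 * (ρ + 1) * ηS = ρ * (6 * (1 + 1 / ρ) * ηS) := by field_simp
        _ ≤ ρ * ε := by gcongr
    have h3 : 0 < ρ * ε := by positivity
    nlinarith [mul_nonneg hρ.le hS0]
  have hlam : ∀ i, 0 ≤ lam i := fun i => by
    rw [← eigenvalue_eq_norm_krylovMap hv i]; positivity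
  have hσ0 : 0 ≤ discardedSum lam ε := Finset.sum_nonneg fun i _ => hlam i
  have hσD : discardedSum lam ε ≤ D * ε := by
    calc discardedSum lam ε ≤ ∑ i with lam i ≤ ε, ε :=
          Finset.sum_le_sum fun i hi => (Finset.mem_filter.1 hi).2
      _ ≤ ∑ _i : Fin D, ε :=
          Finset.sum_le_sum_of_subset_of_nonneg (Finset.filter_subset _ _) fun _ _ _ => hε.le
      _ = D * ε := by simp
  have hσ : ∀ t x, x ≠ 0 → act (overlapMatrix H ψ₀ D + ΔS) x = ((t : ℝ) : ℂ) • x → t ≤ ε →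
      t ≤ discardedSum lam ε + ηS := by
    intro t x hx0 hx ht
    obtain ⟨i, hi⟩ := exists_eigenvalue_near hv ΔS hx0 hx
    have hi := abs_le.1 hi
    -- A noisy eigenvalue at or below `ε` must come from a discarded one, which is a single term of
    -- the discarded sum.
    rcases le_or_gt (lam i) ε with hle | hgt
    · have : lam i ≤ discardedSum lam ε :=
        Finset.single_le_sum (f := lam) (fun j _ => hlam j) (by simp [hle])
      linarith [hi.1]
    · have := hN.gap_above i hgt
      nlinarith [hi.2]
  obtain ⟨E', hlow, hb⟩ := exists_isLowest_abs_sub_le hH hφ hE hE0 hψ hg hg0 hD hΔH hΔS hε hεg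
    hη hσ hσ0 hσD
  refine ⟨E', hlow, fun δ hδ => (hb δ hδ).trans ?_⟩
  have h1 := inv_le_two_mul_add_inv_pow hD hg0 hg1 hδ
  have h2 : 0 ≤ ((D : ℝ) ^ 4 * noiseRate ΔH ΔS) ^ (1 / (1 + α)) := by
    have : 0 ≤ noiseRate ΔH ΔS := Real.sqrt_nonneg _
    positivity
  have h3 : 0 ≤ √δ * discardedSum lam ε / g ^ 2 := by positivity
  have h4 : 0 ≤ 1 / g ^ 2 * ((1 + δ / 2) ^ D)⁻¹ := by positivity
  have h5 : 401 / (D : ℝ) = 401 * (1 / D) := by ring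
  rw [h5, errorScale]
  linarith

/-- An admissible threshold is at least of the order of the noise to the power `1 / (1 + α)`. -/
theorem rpow_le_of_admissible {D : ℕ} (hD : 1 ≤ D) {A B : Matrix (Fin D) (Fin D) ℂ}
    {lam : Fin D → ℝ} {v : Fin D → EuclideanSpace ℂ (Fin D)} {g α ε η : ℝ} (hg0 : 0 < g)
    (hg1 : g ≤ 1) (hB : 1 ≤ specNorm B) (hα : 0 ≤ α) (hη : 0 ≤ η)
    (h : AdmissibleThreshold A B lam v g α ε 0 η) :
    ((D : ℝ) ^ 4 * η) ^ (1 / (1 + α)) ≤ ε := by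
  have hε1 := le_one_of_admissible hD hg0 hg1 h
  obtain ⟨hε, -, μ, hμ, ρ, hρ, hN⟩ := h
  obtain ⟨hchi, -⟩ := add_le_chi (ηH := 0) (hε1.trans hB) hε hα hμ hρ hη
  have h1 : ε ^ (-α) ≤ (specNorm B / ε) ^ α := by
    rw [Real.rpow_neg hε.le, ← Real.inv_rpow hε.le, inv_eq_one_div]
    gcongr
  have h2 : ε ^ (-α) * η ≤ chi (specNorm B) α μ ρ ε 0 η := by
    refine le_trans ?_ hchi
    have hρ' : 0 < 1 / ρ := by positivity
    have h6 : (1 : ℝ) ≤ 6 * (1 + 1 / ρ) := by linarith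
    have h7 : 1 * ε ^ (-α) * η ≤ 6 * (1 + 1 / ρ) * (specNorm B / ε) ^ α * η := by gcongr
    linarith
  have h3 : (D : ℝ) ^ 4 * (ε ^ (-α) * η) ≤ ε :=
    (mul_le_mul_of_nonneg_left h2 (by positivity)).trans hN.noise_bound
  -- The threshold occurs on both sides of the noise bound, once as `ε^(-α)`; collecting the powers
  -- gives the exponent `1/(1 + α)`.
  have h4 : (D : ℝ) ^ 4 * η ≤ ε ^ (1 + α) := by
    rw [Real.rpow_add hε, Real.rpow_one]
    calc (D : ℝ) ^ 4 * η = (D : ℝ) ^ 4 * (ε ^ (-α) * η) * ε ^ α := by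
          rw [Real.rpow_neg hε.le]
          have : 0 < ε ^ α := Real.rpow_pos_of_pos hε α
          field_simp
      _ ≤ ε * ε ^ α := by gcongr
  have h5 : 0 < 1 + α := by linarith
  calc ((D : ℝ) ^ 4 * η) ^ (1 / (1 + α)) ≤ (ε ^ (1 + α)) ^ (1 / (1 + α)) := by gcongr
    _ = ε := by rw [← Real.rpow_mul hε.le, mul_one_div_cancel h5.ne', Real.rpow_one]

/-! ### Existence of admissible thresholds -/

theorem isRegularizedEigenpair_combination {D : ℕ} {A B : Matrix (Fin D) (Fin D) ℂ} {ε F : ℝ}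
    {x y : EuclideanSpace ℂ (Fin D)} (hx : IsRegularizedEigenpair A B ε F x)
    (hy : IsRegularizedEigenpair A B ε F y) (a b : ℂ) (h : a • x + b • y ≠ 0) :
    IsRegularizedEigenpair A B ε F (a • x + b • y) := by
  refine ⟨Submodule.add_mem _ (Submodule.smul_mem _ _ hx.1) (Submodule.smul_mem _ _ hy.1), h,
    fun z hz => ?_⟩
  have h1 := hx.2.2 z hz
  have h2 := hy.2.2 z hz
  simp only [act, map_add, map_smul, inner_add_right, inner_smul_right] at *
  rw [h1, h2]
  ring

/-- If the threshold only discards the kernel of the overlap matrix, the noiseless regularized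
problem has simple eigenvalues. -/
theorem lt_of_isSecondLowest {N D : ℕ} {H : Matrix (Fin N) (Fin N) ℂ} (hH : H.IsHermitian)
    {ψ₀ : EuclideanSpace ℂ (Fin N)} {lam : Fin D → ℝ}
    {v : OrthonormalBasis (Fin D) ℂ (EuclideanSpace ℂ (Fin D))}
    (hv : ∀ i, act (overlapMatrix H ψ₀ D) (v i) = (lam i : ℂ) • v i) {ε : ℝ} (hε : 0 < ε)
    (hlam : ∀ i, lam i ≤ ε → lam i ≤ 0) {E₀' E₁' : ℝ}
    (h0 : IsLowest (projectedMatrix H ψ₀ D) (overlapMatrix H ψ₀ D) ε E₀')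
    (h1 : IsSecondLowest (projectedMatrix H ψ₀ D) (overlapMatrix H ψ₀ D) ε E₀' E₁') :
    E₀' < E₁' := by
  obtain ⟨x₀, x₁, hx₀, hx₁, hli⟩ := h1.1
  refine lt_of_le_of_ne (h0.2 ⟨x₁, hx₁⟩) ?_
  rintro rfl
  set V := krylovMap H ψ₀ D with hV
  -- A two-dimensional eigenspace contains a nonzero vector whose Krylov image is orthogonal to
  -- `ψ₀`.
  obtain ⟨u, hu, huψ⟩ : ∃ u, IsRegularizedEigenpair (projectedMatrix H ψ₀ D)
      (overlapMatrix H ψ₀ D) ε E₀' u ∧ inner ℂ ψ₀ (V u) = 0 := by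
    by_cases hp : inner ℂ ψ₀ (V x₀) = 0
    · exact ⟨x₀, hx₀, hp⟩
    · refine ⟨_, isRegularizedEigenpair_combination hx₀ hx₁ (inner ℂ ψ₀ (V x₁))
        (-inner ℂ ψ₀ (V x₀)) ?_, ?_⟩
      · intro h
        have := (LinearIndependent.pair_iff.1 hli _ _ h).2
        exact hp (neg_eq_zero.1 this)
      · simp only [map_add, map_smul, inner_add_right, inner_smul_right]
        ring
  set K := keptSpace (overlapMatrix H ψ₀ D) ε with hK
  -- What is discarded has zero Krylov image, so the eigenvalue equation on the kept space extends
  -- to all test vectors.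
  have hker : ∀ w ∈ Kᗮ, V w = 0 := by
    intro w hw
    have h := quadForm_le_of_orthogonal_keptSpace hv hlam hw
    rw [quadForm_overlapMatrix, zero_mul] at h
    exact norm_eq_zero.1 (pow_eq_zero_iff two_ne_zero |>.1 (le_antisymm h (sq_nonneg _)))
  have hVu : V u = 0 := by
    refine krylovMap_eq_zero_of_compression_eigenvector hH (F := E₀') (fun y => ?_) huψ
    have hy : V y = V (K.starProjection y) := by
      have := hker _ (Submodule.sub_starProjection_mem_orthogonal (K := K) y)
      rwa [map_sub, sub_eq_zero] at this
    have h := hu.2.2 _ (Submodule.starProjection_apply_mem K y)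
    rw [inner_act_projectedMatrix, inner_act_overlapMatrix, ← hV, ← hy] at h
    exact h
  have h := le_quadForm_of_mem_keptSpace hv hu.1
  rw [quadForm_overlapMatrix, ← hV, hVu] at h
  have h2 : 0 < ‖u‖ := norm_pos_iff.2 hu.2.1
  have h3 : 0 < ε * ‖u‖ ^ 2 := by positivity
  simp at h
  linarith

theorem exists_relative_bound {N D : ℕ} {H : Matrix (Fin N) (Fin N) ℂ}
    {ψ₀ : EuclideanSpace ℂ (Fin N)} {lam : Fin D → ℝ}
    {v : OrthonormalBasis (Fin D) ℂ (EuclideanSpace ℂ (Fin D))}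
    (hv : ∀ i, act (overlapMatrix H ψ₀ D) (v i) = (lam i : ℂ) • v i) (α : ℝ) :
    ∃ μ > 0, ∀ i j, ‖inner ℂ (v i) (act (projectedMatrix H ψ₀ D) (v j))‖ ≤
      μ * min (lam i) (lam j) ^ (1 - α) * max (lam i) (lam j) ^ α := by
  have hlam : ∀ i, 0 ≤ lam i := fun i => by
    rw [← eigenvalue_eq_norm_krylovMap hv i]; positivity
  have hV : ∀ i, lam i = 0 → krylovMap H ψ₀ D (v i) = 0 := by
    intro i hi
    have := eigenvalue_eq_norm_krylovMap hv i
    rw [hi] at this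
    exact norm_eq_zero.1 (pow_eq_zero_iff two_ne_zero |>.1 this)
  set r : Fin D → Fin D → ℝ :=
    fun i j => min (lam i) (lam j) ^ (1 - α) * max (lam i) (lam j) ^ α with hr
  have hr0 : ∀ i j, 0 ≤ r i j := fun i j => by
    have := hlam i
    have := hlam j
    positivity
  set f : Fin D → Fin D → ℝ :=
    fun i j => ‖inner ℂ (v i) (act (projectedMatrix H ψ₀ D) (v j))‖ with hf
  have hq0 : ∀ i j, 0 ≤ f i j / r i j := fun i j => div_nonneg (norm_nonneg _) (hr0 i j)
  -- A vanishing eigenvalue means that `V` kills the eigenvector, so `f i j = 0` and the value of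
  -- the quotient, even by zero, is harmless. The sum of all quotients then serves for `μ`.
  have hq : ∀ i j, f i j ≤ f i j / r i j * r i j := by
    intro i j
    rcases (hlam i).eq_or_lt with hi | hi
    · have : f i j = 0 := by
        simp only [hf]
        rw [inner_act_projectedMatrix, hV i hi.symm, inner_zero_left, norm_zero]
      simp [this]
    rcases (hlam j).eq_or_lt with hj | hj
    · have : f i j = 0 := by
        simp only [hf]
        rw [inner_act_projectedMatrix, hV j hj.symm]
        simp [act]
      simp [this]
    · have : 0 < r i j :=
        mul_pos (Real.rpow_pos_of_pos (lt_min hi hj) _)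
          (Real.rpow_pos_of_pos (lt_max_of_lt_left hi) _)
      rw [div_mul_cancel₀ _ this.ne']
  refine ⟨1 + ∑ i, ∑ j, f i j / r i j,
    add_pos_of_pos_of_nonneg one_pos (Finset.sum_nonneg fun i _ => Finset.sum_nonneg fun j _ =>
      hq0 i j), fun i j => ?_⟩
  rw [mul_assoc]
  refine (hq i j).trans (mul_le_mul_of_nonneg_right ?_ (hr0 i j))
  have h1 : f i j / r i j ≤ ∑ j', f i j' / r i j' :=
    Finset.single_le_sum (f := fun j' => f i j' / r i j') (fun j' _ => hq0 i j')
      (Finset.mem_univ j)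
  have h2 : ∑ j', f i j' / r i j' ≤ ∑ i', ∑ j', f i' j' / r i' j' :=
    Finset.single_le_sum (f := fun i' => ∑ j', f i' j' / r i' j')
      (fun i' _ => Finset.sum_nonneg fun j' _ => hq0 i' j') (Finset.mem_univ i)
  linarith

theorem exists_pos_le_of_pos {ι : Type*} [Finite ι] (f : ι → ℝ) :
    ∃ m > 0, ∀ i, 0 < f i → m ≤ f i := by
  rcases isEmpty_or_nonempty {i // 0 < f i} with h | h
  · exact ⟨1, one_pos, fun i hi => (h.false ⟨i, hi⟩).elim⟩
  · obtain ⟨i, hi⟩ := Finite.exists_min fun i : {i // 0 < f i} => f i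
    exact ⟨f i, i.2, fun j hj => hi ⟨j, hj⟩⟩

/-- All sufficiently small noise rates have an admissible threshold. -/
theorem exists_noiseSmallEnough {N D : ℕ} {H : Matrix (Fin N) (Fin N) ℂ} (hH : H.IsHermitian)
    {ψ₀ : EuclideanSpace ℂ (Fin N)} (hD : 1 ≤ D) {lam : Fin D → ℝ}
    {v : OrthonormalBasis (Fin D) ℂ (EuclideanSpace ℂ (Fin D))}
    (hv : ∀ i, act (overlapMatrix H ψ₀ D) (v i) = (lam i : ℂ) • v i) {g : ℝ} (hg : 0 < g)
    (α : ℝ) :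
    ∃ η₁ > 0, ∀ η, 0 ≤ η → η ≤ η₁ →
      NoiseSmallEnough (projectedMatrix H ψ₀ D) (overlapMatrix H ψ₀ D) lam v g α η := by
  have hD' : (1 : ℝ) ≤ D := by exact_mod_cast hD
  obtain ⟨m, hm, hmle⟩ := exists_pos_le_of_pos lam
  obtain ⟨μ, hμ, hrel⟩ := exists_relative_bound hv α
  -- Half the least positive eigenvalue leaves room for `ρ = 1` and discards only the kernel; the
  -- second bound gives `2√(Dε) < g`. The choice does not depend on the noise.
  set ε := min (m / 2) (g ^ 2 / (8 * D)) with hεdef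
  have hε : 0 < ε := by positivity
  have hεm : 2 * ε ≤ m := by linarith [min_le_left (m / 2) (g ^ 2 / (8 * D))]
  have hεg : 2 * √(D * ε) < g := by
    have h1 : D * ε ≤ g ^ 2 / 8 := by
      calc D * ε ≤ D * (g ^ 2 / (8 * D)) := by gcongr; exact min_le_right _ _
        _ = g ^ 2 / 8 := by field_simp
    have h2 : √(D * ε) < g / 2 := by
      rw [Real.sqrt_lt' (by positivity)]
      nlinarith [sq_nonneg g, pow_pos hg 2]
    linarith
  have hdisc : ∀ i, lam i ≤ ε → lam i ≤ 0 := by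
    intro i hi
    by_contra! hpos
    linarith [hmle i hpos]
  obtain ⟨κ, hκ, hκle⟩ : ∃ κ > 0, ∀ E₀' E₁',
      IsLowest (projectedMatrix H ψ₀ D) (overlapMatrix H ψ₀ D) ε E₀' →
      IsSecondLowest (projectedMatrix H ψ₀ D) (overlapMatrix H ψ₀ D) ε E₀' E₁' →
      κ ≤ Real.arctan E₁' - Real.arctan E₀' := by
    by_cases hex : ∃ E₀' E₁',
        IsLowest (projectedMatrix H ψ₀ D) (overlapMatrix H ψ₀ D) ε E₀' ∧
        IsSecondLowest (projectedMatrix H ψ₀ D) (overlapMatrix H ψ₀ D) ε E₀' E₁'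
    · obtain ⟨a, b, ha, hb⟩ := hex
      refine ⟨Real.arctan b - Real.arctan a,
        sub_pos.2 (Real.arctan_strictMono (lt_of_isSecondLowest hH hv hε hdisc ha hb)),
        fun a' b' ha' hb' => ?_⟩
      obtain rfl := ha'.unique ha
      obtain rfl := IsLeast.unique hb' hb
      exact le_rfl
    · exact ⟨1, one_pos, fun a b ha hb => (hex ⟨a, b, ha, hb⟩).elim⟩
  -- Capping the gap at `1 < π/2` allows `arcsin (sin κ') = κ'`.
  set κ' := min κ 1 with hκ'
  have hκ'0 : 0 < κ' := lt_min hκ one_pos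
  have hκ'1 : κ' ≤ 1 := min_le_right _ _
  have hpi := Real.pi_gt_three
  have hs0 : 0 < Real.sin κ' := Real.sin_pos_of_pos_of_lt_pi hκ'0 (by linarith)
  set P : ℝ := 3 * (2 + μ) * (1 + 1 / 1) * (specNorm (overlapMatrix H ψ₀ D) / ε) ^ α with hP
  have hP0 : 0 ≤ P := by
    have := specNorm_nonneg (overlapMatrix H ψ₀ D)
    positivity
  set M : ℝ := (D : ℝ) ^ 4 * (P + 1) with hM
  have hM0 : 0 < M := by positivity
  refine ⟨min ε (ε * Real.sin κ' / M), by positivity, fun η hη hη₁ => ⟨ε, ?_⟩⟩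
  intro ηH ηS hηH hηS hsum
  have hSle : ηS ≤ η := le_of_sq_le_sq (by nlinarith) hη
  have hHle : ηH ≤ η := le_of_sq_le_sq (by nlinarith) hη
  have hchi : (D : ℝ) ^ 4 * chi (specNorm (overlapMatrix H ψ₀ D)) α μ 1 ε ηH ηS ≤
      ε * Real.sin κ' := by
    calc (D : ℝ) ^ 4 * chi (specNorm (overlapMatrix H ψ₀ D)) α μ 1 ε ηH ηS
        = (D : ℝ) ^ 4 * (P * ηS + ηH) := by rw [chi]
      _ ≤ (D : ℝ) ^ 4 * (P * η + η) := by gcongr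
      _ = M * η := by rw [hM]; ring
      _ ≤ M * (ε * Real.sin κ' / M) := by
          gcongr
          exact hη₁.trans (min_le_right _ _)
      _ = _ := by field_simp
  refine ⟨hε, hεg, μ, hμ, 1, one_pos, ⟨fun i hi => ?_, hrel, fun i hi => ?_, ?_, ?_⟩⟩
  · linarith [hdisc i hi, hη₁.trans (min_le_left _ _)]
  · linarith [hmle i (hε.trans hi)]
  · refine hchi.trans ?_
    have := Real.sin_le_one κ'
    nlinarith
  · intro a b ha hb
    refine le_trans ?_ (hκle a b ha hb)
    refine le_trans ?_ (min_le_left κ 1)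
    rw [← hκ', ← Real.arcsin_sin (by linarith : -(Real.pi / 2) ≤ κ') (by linarith)]
    refine Real.monotone_arcsin ?_
    rw [div_le_iff₀ hε]
    linarith

end

/-! ### Assembly -/

theorem theorem1 :
    ∃ c > (0 : ℝ), ∃ C > (0 : ℝ),
    ∀ (N : ℕ) [NeZero N] (H : Matrix (Fin N) (Fin N) ℂ) (_ : H.IsHermitian)
      -- the energies in increasing order and the corresponding eigenstates
      (E : Fin N → ℝ) (φ : OrthonormalBasis (Fin N) ℂ (EuclideanSpace ℂ (Fin N)))
      (_ : Monotone E) (_ : ∀ i, E i ∈ Set.Icc (-1 : ℝ) 1)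
      (_ : ∀ i, act H (φ i) = (E i : ℂ) • φ i)
      -- the reference state and the Krylov dimension
      (ψ₀ : EuclideanSpace ℂ (Fin N)) (_ : ‖ψ₀‖ = 1)
      (γ₀ : ℂ) (_ : γ₀ = inner ℂ (φ 0) ψ₀) (_ : γ₀ ≠ 0)
      (D : ℕ) (_ : 1 ≤ D)
      (Hk Sk : Matrix (Fin D) (Fin D) ℂ)
      (_ : Hk = projectedMatrix H ψ₀ D) (_ : Sk = overlapMatrix H ψ₀ D)
      -- the eigenpairs of the overlap matrix, from largest to smallest eigenvalue
      (lam : Fin D → ℝ) (v : OrthonormalBasis (Fin D) ℂ (EuclideanSpace ℂ (Fin D)))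
      (_ : Antitone lam) (_ : ∀ i, act Sk (v i) = (lam i : ℂ) • v i)
      (α : ℝ) (_ : α ∈ Set.Icc (0 : ℝ) (1 / 2)),
      -- all sufficiently small noise rates are small enough in the precise sense
      (∃ η₁ > 0, ∀ η, 0 ≤ η → η ≤ η₁ → NoiseSmallEnough Hk Sk lam v ‖γ₀‖ α η) ∧
      -- if the noise rate is small enough, a threshold of the claimed size gives the bound
      (∀ η, 0 ≤ η → NoiseSmallEnough Hk Sk lam v ‖γ₀‖ α η →
        ∃ ε > 0, c * ((D : ℝ) ^ 4 * η) ^ (1 / (1 + α)) ≤ ε ∧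
          ∀ ΔH ΔS : Matrix (Fin D) (Fin D) ℂ, ΔH.IsHermitian → ΔS.IsHermitian →
            noiseRate ΔH ΔS = η →
            ∃ E', IsLowest (Hk + ΔH) (Sk + ΔS) ε E' ∧
              ∀ δ > 0, |E' - E 0| ≤ C * errorScale D α η (discardedSum lam ε) ‖γ₀‖ δ) ∧
      -- the bound holds at every threshold that is admissible for the actual perturbations
      (∀ ΔH ΔS : Matrix (Fin D) (Fin D) ℂ, ΔH.IsHermitian → ΔS.IsHermitian →
        ∀ ε, AdmissibleThreshold Hk Sk lam v ‖γ₀‖ α ε (specNorm ΔH) (specNorm ΔS) →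
          ∃ E', IsLowest (Hk + ΔH) (Sk + ΔS) ε E' ∧
            ∀ δ > 0, |E' - E 0| ≤
              C * errorScale D α (noiseRate ΔH ΔS) (discardedSum lam ε) ‖γ₀‖ δ) := by
  refine ⟨1, one_pos, 6000, by norm_num, ?_⟩
  intro N _ H hH E φ hmono hE hφ ψ₀ hψ γ₀ hγ hγ0 D hD Hk Sk hHk hSk lam v _ hv α hα
  subst hHk hSk
  have hg : ‖γ₀‖ = ‖inner ℂ (φ 0) ψ₀‖ := by rw [hγ]
  have hg0 : 0 < ‖γ₀‖ := norm_pos_iff.2 hγ0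
  have hg1 : ‖γ₀‖ ≤ 1 := by
    rw [hg]
    refine (norm_inner_le_norm _ _).trans_eq ?_
    rw [φ.norm_eq_one, hψ, one_mul]
  have hE0 : ∀ i, E 0 ≤ E i := fun i => hmono (Fin.zero_le i)
  have hbound := fun (ΔH ΔS : Matrix (Fin D) (Fin D) ℂ) (hΔH : ΔH.IsHermitian)
      (hΔS : ΔS.IsHermitian) (ε : ℝ) hadm =>
    exists_isLowest_abs_sub_le_of_admissible hH hφ hE hE0 hψ hg hg0 hD hv hα.1 hΔH hΔS (ε := ε)
      hadm
  refine ⟨exists_noiseSmallEnough hH hD hv hg0 α, ?_, hbound⟩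
  rintro η hη ⟨ε, hadm⟩
  -- Admissibility holds for every split of the noise; placing it all in the overlap matrix gives
  -- the strongest constraint on `ε`.
  have h0 := hadm 0 η le_rfl hη (by ring)
  refine ⟨ε, h0.1, ?_, fun ΔH ΔS hΔH hΔS hnoise => ?_⟩
  · rw [one_mul]
    exact rpow_le_of_admissible hD hg0 hg1 (one_le_specNorm_overlapMatrix H hψ hD) hα.1 hη h0
  · have hsum : specNorm ΔH ^ 2 + specNorm ΔS ^ 2 = η ^ 2 := by
      rw [← hnoise, noiseRate, Real.sq_sqrt (by positivity)]
    subst hnoise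
    exact hbound ΔH ΔS hΔH hΔS ε
      (hadm _ _ (specNorm_nonneg ΔH) (specNorm_nonneg ΔS) hsum)
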